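/- For a scheme $Y$ write $|Y|$ for its set of closed points, and let $Z_0^{\mathrm{eff}}(Y)$ be the free commutative monoid on $|Y|$ (effective $0$-cycles). **Local statement.** Let $X$ be a scheme of finite type over a finite field $\mathbb F_q$. For $x\in|X|$ put $\deg(x)=[\kappa(x):\mathbb F_q]$, and for $\alpha=\sum_{i=1}^r a_ix_i\in Z_0^{\mathrm{eff}}(X)$ with distinct $x_i$ and $a_i\ge 1$ put $$\deg(\alpha)=\sum_i a_i\deg(x_i),\qquad \psi_X(\alpha)=q^{\deg(\alpha)}\prod_{i=1}^r\bigl(1+q^{-\deg(x_i)}\bigr).$$ Let $Z(X,t)=\prod_{x\in|X|}(1-t^{\deg(x)})^{-1}\in\mathbb Q[[t]]$. Then there are only finitely many effective $0$-cycles of each degree, the product defining $Z(X,t)$ converges formally (each coefficient of the finite partial products is eventually constant), $Z(X,0)=1$, and in $\mathbb Q[[t]]$ $$\Psi(X,t):=\sum_{\alpha\in Z_0^{\mathrm{eff}}(X)}\psi_X(\alpha)\,t^{\deg(\alpha)}=\frac{Z(X,t)\,Z(X,qt)}{Z(X,t^2)} .$$ **Global statement.** Let $X$ be an arithmetic scheme,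 i.e. a scheme of finite type over $\operatorname{Spec}\mathbb Z$, and for each prime $p$ let $X_p=X\times_{\operatorname{Spec}\mathbb Z}\operatorname{Spec}\mathbb F_p$. For $Y=X$ and $Y=X\times\mathbb A^1$ let $$\zeta_Y(s)=\prod_{y\in|Y|}\bigl(1-N(y)^{-s}\bigr)^{-1},\quad N(y)=\#\kappa(y),\qquad\text{and let}\qquad \Psi_X(s)=\prod_{p\ \mathrm{prime}}\Psi(X_p,p^{-s}).$$ Then $$\Psi_X(s)=\frac{\zeta_X(s)\,\zeta_{X\times\mathbb A^1}(s)}{\zeta_X(2s)}$$ in both of the following senses. 1. As formal Dirichlet series: the products defining $\Psi_X$, $\zeta_X$ and $\zeta_{X\times\mathbb A^1}$ converge formally, $\zeta_X(2s)$ is invertible in the ring of formal Dirichlet series over $\mathbb Q$, and the identity holds in that ring. 2. As functions of the complex variable $s$: the series $\sum_{y\in|X\times\mathbb A^1|}N(y)^{-\operatorname{Re}(s)}$ converges for all $s$ in some right half-plane; and for every $s\in\mathbb C$ for which it converges, all series $\Psi(X_p,p^{-s})$ converge absolutely, the products over primes and over closed points defining $\Psi_X(s)$, $\zeta_X(s)$,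 $\zeta_X(2s)$ and $\zeta_{X\times\mathbb A^1}(s)$ converge unconditionally, $\zeta_X(2s)\ne 0$, and the identity holds. -/

import Mathlib

open AlgebraicGeometry CategoryTheory Filter

noncomputable section

namespace ArithPsi

/-- The cardinality `N(x)` of the residue field of `X` at the closed point `x`. -/
def pointNorm (X : Scheme.{0}) (x : closedPoints X) : ℕ :=
  Nat.card (X.residueField x.1)

/-- The monoid of effective `0`-cycles of `X`: the free commutative monoid on the closed points. -/
abbrev EffZeroCycle (X : Scheme.{0}) : Type := closedPoints X →₀ ℕ

section OverField

variable {k : Type} [Field k] {X : Scheme.{0}} (f : X ⟶ Spec (.of k))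

/-- The degree `[κ(x) : k]` of a closed point `x` of the `k`-scheme `X`. Here `k` is identified
with the residue field of `Spec k` at its unique point. -/
def pointDegree (x : closedPoints X) : ℕ := f.residueDegree x.1

/-- The degree `∑ aᵢ deg(xᵢ)` of the effective `0`-cycle `∑ aᵢ xᵢ`. -/
def cycleDegree (α : EffZeroCycle X) : ℕ := α.sum fun x a => a * pointDegree f x

/-- `ψ_X(α) = q ^ deg(α) * ∏ᵢ (1 + q ^ (-deg(xᵢ)))` for `α = ∑ aᵢ xᵢ` with distinct `xᵢ` and
`aᵢ ≥ 1`, where `q` is the cardinality of `k`. -/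
def psi (α : EffZeroCycle X) : ℚ :=
  (Nat.card k : ℚ) ^ cycleDegree f α *
    ∏ x ∈ α.support, (1 + (Nat.card k : ℚ) ^ (-(pointDegree f x : ℤ)))

/-- The formal power series `Ψ(X, t) = ∑_α ψ_X(α) t ^ deg(α)`. -/
def psiSeries : PowerSeries ℚ :=
  PowerSeries.mk fun n => ∑ᶠ α ∈ {α : EffZeroCycle X | cycleDegree f α = n}, psi f α

/-- The value `Ψ(X, z) = ∑_α ψ_X(α) z ^ deg(α)` at a complex number `z`. -/
def psiValue (z : ℂ) : ℂ := ∑' α : EffZeroCycle X, (psi f α : ℂ) * z ^ cycleDegree f α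

/-- The factor `1 / (1 - t ^ deg(x))` of the Hasse--Weil zeta function at a closed point `x`. -/
def hasseWeilFactor (x : closedPoints X) : PowerSeries ℚ :=
  (1 - PowerSeries.X ^ pointDegree f x)⁻¹

open scoped PowerSeries.WithPiTopology in
/-- The Hasse--Weil zeta function `Z(X, t) = ∏_x 1 / (1 - t ^ deg(x))`, where `x` runs through the
closed points; the formal product is taken coefficientwise (with discrete coefficients). -/
def hasseWeilZeta : PowerSeries ℚ :=
  letI : TopologicalSpace ℚ := ⊥
  ∏' x : closedPoints X, hasseWeilFactor f x

end OverField

section Global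

/-- The fibre `X_p` of `X → Spec ℤ` over a prime `p`. -/
def primeFibre {X : Scheme.{0}} (f : X ⟶ Spec (.of ℤ)) (p : Nat.Primes) : Scheme.{0} :=
  Limits.pullback f (Spec.map (CommRingCat.ofHom (Int.castRingHom (ZMod p))))

/-- The structure morphism `X_p → Spec 𝔽_p`. -/
def primeFibreMap {X : Scheme.{0}} (f : X ⟶ Spec (.of ℤ)) (p : Nat.Primes) :
    primeFibre f p ⟶ Spec (.of (ZMod p)) :=
  Limits.pullback.snd f (Spec.map (CommRingCat.ofHom (Int.castRingHom (ZMod p))))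

instance (p : Nat.Primes) : Fact (p : ℕ).Prime := ⟨p.2⟩

/-- The affine line `X × 𝔸¹` over `X`. -/
abbrev affineLine (X : Scheme.{0}) : Scheme.{0} := AffineSpace PUnit X

/-- The formal Dirichlet series `1 / (1 - N(x) ^ (-s))`. -/
def zetaFactor (X : Scheme.{0}) (x : closedPoints X) : ArithmeticFunction ℚ :=
  ArithmeticFunction.ofPowerSeries (pointNorm X x) (1 - PowerSeries.X)⁻¹

/-- The zeta function `ζ_X(s) = ∏_x 1 / (1 - N(x) ^ (-s))` as a formal Dirichlet series. -/
def formalZeta (X : Scheme.{0}) : ArithmeticFunction ℚ :=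
  ArithmeticFunction.eulerProduct (zetaFactor X)

/-- The formal Dirichlet series `F(2s) = ∑ aₙ (n ^ 2) ^ (-s)` for `F(s) = ∑ aₙ n ^ (-s)`. -/
def atTwoS (F : ArithmeticFunction ℚ) : ArithmeticFunction ℚ :=
  ⟨fun n => open Classical in if IsSquare n then F n.sqrt else 0, by simp⟩

/-- The formal Dirichlet series `Ψ(X_p, p ^ (-s))`. -/
def psiFactor {X : Scheme.{0}} (f : X ⟶ Spec (.of ℤ)) (p : Nat.Primes) : ArithmeticFunction ℚ :=
  ArithmeticFunction.ofPowerSeries p (psiSeries (primeFibreMap f p))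

/-- `Ψ_X(s) = ∏_p Ψ(X_p, p ^ (-s))` as a formal Dirichlet series. -/
def formalPsi {X : Scheme.{0}} (f : X ⟶ Spec (.of ℤ)) : ArithmeticFunction ℚ :=
  ArithmeticFunction.eulerProduct (psiFactor f)

/-- The zeta function `ζ_X(s) = ∏_x 1 / (1 - N(x) ^ (-s))` of the complex variable `s`. -/
def zeta (X : Scheme.{0}) (s : ℂ) : ℂ :=
  ∏' x : closedPoints X, (1 - (pointNorm X x : ℂ) ^ (-s))⁻¹

/-- The function `Ψ_X(s) = ∏_p Ψ(X_p, p ^ (-s))` of the complex variable `s`. -/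
def globalPsi {X : Scheme.{0}} (f : X ⟶ Spec (.of ℤ)) (s : ℂ) : ℂ :=
  ∏' p : Nat.Primes, psiValue (primeFibreMap f p) ((p : ℂ) ^ (-s))

end Global

end ArithPsi

end

/-!
The closed points of an arithmetic scheme `X` are those of its fibres `X_p`, with
`N(x) = p ^ deg x`, and the closed points of `X × 𝔸¹` over `x` are the monic irreducible polynomials
over `κ(x)`. Unique factorization, together with the count `N(x) ^ n` of monic polynomials of
degree `n`, turns the Euler product over those polynomials into `1 / (1 - N(x) w)` with
`w = N(x) ^ (-s)`, so that adjoining an affine line replaces `Z(X, t)` by `Z(X, qt)`.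

Since `ψ` is multiplicative over disjoint cycles, `Ψ` has an Euler product too, with local factor
`1 + ∑_{a ≥ 1} (N w) ^ a (1 + N⁻¹) = (1 + w) / (1 - N w) = (1 - w ^ 2) / ((1 - w) (1 - N w))`.
The identity of formal Dirichlet series reduces to this one prime at a time, both sides being
multiplicative. Analytically, convergence of `∑ N(y) ^ (-σ)` over `X × 𝔸¹` bounds
`∑ N(x) ^ (1 - σ)`, because `x` has `N(x)` rational points above it, and forces `σ > 1`, because the
Euler product over monic irreducible polynomials diverges at `σ = 1`; all products then converge
absolutely.
-/

noncomputable section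

namespace ArithPsi

universe u

instance isJacobsonRing_int : IsJacobsonRing ℤ := by
  refine isJacobsonRing_iff_prime_eq.mpr fun P hP => ?_
  obtain rfl | hbot := eq_or_ne P ⊥
  · refine eq_bot_iff.mpr fun x hx => Ideal.mem_bot.mpr ?_
    obtain h | h := Int.isUnit_iff.mp (Ideal.mem_jacobson_bot.mp hx x) <;> nlinarith
  · have := hP.isMaximal hbot
    exact Ideal.jacobson_eq_self_of_isMaximal

section ClosedPoints

lemma bijective_residueFieldMap {Z Y : Scheme.{u}} (i : Z ⟶ Y) [IsPreimmersion i] (z : Z) :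
    Function.Bijective (i.residueFieldMap z) := by
  refine ⟨RingHom.injective _, fun y => ?_⟩
  obtain ⟨t, rfl⟩ := Z.residue_surjective z y
  obtain ⟨u, rfl⟩ := SurjectiveOnStalks.stalkMap_surjective i z t
  exact ⟨Y.residue _ u, ConcreteCategory.congr_hom (Scheme.residue_residueFieldMap i z) u⟩

lemma natCard_residueField_apply {Z Y : Scheme.{u}} (i : Z ⟶ Y) [IsPreimmersion i] (z : Z) :
    Nat.card (Y.residueField (i z)) = Nat.card (Z.residueField z) :=
  Nat.card_congr (.ofBijective _ (bijective_residueFieldMap i z))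

lemma natCard_residueField_Spec (R : CommRingCat.{u}) (x : PrimeSpectrum R) :
    Nat.card ((Spec R).residueField x) = Nat.card x.asIdeal.ResidueField :=
  Nat.card_congr (Scheme.Spec.residueFieldIso R x).commRingCatIsoToRingEquiv.toEquiv

lemma natCard_residueField_of_isMaximal {R : Type*} [CommRing R] (I : Ideal R) [I.IsMaximal] :
    Nat.card I.ResidueField = Nat.card (R ⧸ I) :=
  (Nat.card_congr (.ofBijective _ (Ideal.bijective_algebraMap_quotient_residueField I))).symm

/-- The map of closed points induced by a closed immersion. -/
def closedPointsMap {Z Y : Scheme.{u}} (i : Z ⟶ Y) [IsClosedImmersion i] (z : closedPoints Z) :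
    closedPoints Y :=
  ⟨i z.1, by simpa using i.isClosedEmbedding.isClosedMap _ z.2⟩

lemma pointNorm_closedPointsMap {Z Y : Scheme.{0}} (i : Z ⟶ Y) [IsClosedImmersion i]
    (z : closedPoints Z) : pointNorm Y (closedPointsMap i z) = pointNorm Z z :=
  natCard_residueField_apply i z.1

/-- A family of closed immersions whose images are disjoint on closed points and cover all closed
points of `Y` decomposes the set of closed points of `Y`. -/
def sigmaClosedPointsEquiv {Y : Scheme.{u}} {ι : Type*} (Z : ι → Scheme.{u})
    (i : ∀ a, Z a ⟶ Y) [∀ a, IsClosedImmersion (i a)]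
    (hdisj : ∀ a b (z : closedPoints (Z a)) (w : closedPoints (Z b)), i a z.1 = i b w.1 → a = b)
    (hcov : ∀ y : closedPoints Y, ∃ a, y.1 ∈ Set.range (i a)) :
    (Σ a, closedPoints (Z a)) ≃ closedPoints Y :=
  .ofBijective (fun z => closedPointsMap (i z.1) z.2) <| by
    refine ⟨?_, fun y => ?_⟩
    · rintro ⟨a, z⟩ ⟨b, w⟩ h
      have hval : i a z.1 = i b w.1 := congrArg Subtype.val h
      obtain rfl := hdisj a b z w hval
      rw [Subtype.ext ((i a).isClosedEmbedding.injective hval)]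
    · obtain ⟨a, z, hz⟩ := hcov y
      refine ⟨⟨a, z, ?_⟩, Subtype.ext hz⟩
      rw [← (i a).isClosedEmbedding.preimage_closedPoints, Set.mem_preimage, hz]
      exact y.2

end ClosedPoints

section FiniteResidueField

lemma finite_of_moduleFinite_int (K : Type*) [Field K] [Module.Finite ℤ K] : Finite K := by
  obtain ⟨p, hp⟩ := CharP.exists K
  obtain rfl | h0 := eq_or_ne p 0
  · have : CharZero K := CharP.charP_to_charZero K
    have hfield : IsField ℤ :=
      (Algebra.IsIntegral.isField_iff_isField (FaithfulSMul.algebraMap_injective ℤ K)).mpr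
        (Field.toIsField K)
    exact absurd hfield Int.not_isField
  · have : NeZero p := ⟨h0⟩
    let := ZMod.algebra K p
    have : Module.Finite (ZMod p) K := Module.Finite.of_restrictScalars_finite ℤ (ZMod p) K
    exact Module.finite_of_finite (ZMod p)

lemma exists_finite_ringHom_residueField {R : Type u} [CommRing R] [IsJacobsonRing R]
    {X : Scheme.{u}} (f : X ⟶ Spec (.of R)) [LocallyOfFiniteType f] (x : closedPoints X) :
    ∃ φ : R →+* X.residueField x.1, φ.Finite := by
  have := isClosed_singleton_iff_isClosedImmersion.mp x.2
  have hfin : IsFinite (X.fromSpecResidueField x.1 ≫ f) :=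
    isFinite_iff_locallyOfFiniteType_of_jacobsonSpace.mpr inferInstance
  obtain ⟨φ, hφ⟩ := Spec.map_surjective (X.fromSpecResidueField x.1 ≫ f)
  exact ⟨φ.hom, (IsFinite.SpecMap_iff φ).mp (hφ ▸ hfin)⟩

lemma finite_residueField_of_int {X : Scheme.{0}} (f : X ⟶ Spec (.of ℤ)) [LocallyOfFiniteType f]
    (x : closedPoints X) : Finite (X.residueField x.1) := by
  obtain ⟨φ, hφ⟩ := exists_finite_ringHom_residueField f x
  have : Module.Finite ℤ (X.residueField x.1) :=
    RingHom.finite_algebraMap.mp (Subsingleton.elim φ (algebraMap ℤ _) ▸ hφ)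
  exact finite_of_moduleFinite_int _

lemma finite_residueField_of_finite {k : Type u} [Field k] [Finite k] {X : Scheme.{u}}
    (f : X ⟶ Spec (.of k)) [LocallyOfFiniteType f] (x : closedPoints X) :
    Finite (X.residueField x.1) := by
  obtain ⟨φ, hφ⟩ := exists_finite_ringHom_residueField f x
  algebraize [φ]
  exact Module.finite_of_finite k

lemma natCard_residueField_Spec_field {k : Type u} [Field k] (x : Spec (.of k)) :
    Nat.card ((Spec (.of k)).residueField x) = Nat.card k := by
  have hx : x.asIdeal = ⊥ := (eq_bot_or_eq_top _).resolve_right x.2.ne_top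
  have : x.asIdeal.IsMaximal := hx ▸ Ideal.bot_isMaximal
  rw [natCard_residueField_Spec (.of k) x, natCard_residueField_of_isMaximal, hx]
  exact Nat.card_congr (RingEquiv.quotientBot k).toEquiv

variable {k : Type} [Field k] [Finite k] {X : Scheme.{0}} (f : X ⟶ Spec (.of k))
  [LocallyOfFiniteType f] (x : closedPoints X)

lemma pointDegree_pos : 0 < pointDegree f x := by
  have := finite_residueField_of_finite f x
  let := (f.residueFieldMap x.1).hom.toAlgebra
  exact Module.finrank_pos (R := (Spec (.of k)).residueField (f x.1)) (M := X.residueField x.1)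

lemma pointNorm_eq_card_pow : pointNorm X x = Nat.card k ^ pointDegree f x := by
  have := finite_residueField_of_finite f x
  let := (f.residueFieldMap x.1).hom.toAlgebra
  have hcard := Module.natCard_eq_pow_finrank (K := (Spec (.of k)).residueField (f x.1))
    (V := X.residueField x.1)
  rwa [natCard_residueField_Spec_field] at hcard

end FiniteResidueField

section PointCount

variable {R K : Type*} [CommRing R]

lemma ringHom_restrict_injective [Ring K] {s : Set R} (hs : Algebra.adjoin ℤ s = ⊤) :
    Function.Injective fun (φ : R →+* K) (a : s) => φ a := fun _ _ h =>
  RingHom.toIntAlgHom_injective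
    (AlgHom.ext_of_adjoin_eq_top hs fun a ha => congrFun h ⟨a, ha⟩)

lemma encard_univ_ringHom_le [Ring K] [Finite K] {s : Finset R}
    (hs : Algebra.adjoin ℤ (s : Set R) = ⊤) :
    (Set.univ : Set (R →+* K)).encard ≤ (Nat.card K ^ s.card : ℕ) := by
  rw [← (ringHom_restrict_injective (K := K) hs).encard_image]
  refine (Set.encard_le_encard (Set.subset_univ _)).trans_eq ?_
  rw [Set.encard_univ, ENat.card_eq_coe_natCard, Nat.card_fun]
  simp

lemma exists_ringHom_ker_eq (K : Type*) [Field K] [Finite K] (z : PrimeSpectrum R)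
    (hz : Nat.card z.asIdeal.ResidueField = Nat.card K) :
    ∃ φ : R →+* K, RingHom.ker φ = z.asIdeal := by
  have : Finite z.asIdeal.ResidueField := Nat.finite_of_card_ne_zero (hz ▸ Nat.card_pos.ne')
  have := Fintype.ofFinite K
  have := Fintype.ofFinite z.asIdeal.ResidueField
  let e : z.asIdeal.ResidueField ≃+* K :=
    FiniteField.ringEquivOfCardEq (by simpa only [Nat.card_eq_fintype_card] using hz)
  refine ⟨e.toRingHom.comp (algebraMap R _), Ideal.ext fun a => ?_⟩
  simp [RingHom.mem_ker]

lemma encard_natCard_primeSpectrum_residueField_eq_le {s : Finset R}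
    (hs : Algebra.adjoin ℤ (s : Set R) = ⊤) {n : ℕ} (hn : n ≠ 0) :
    {z : PrimeSpectrum R | Nat.card z.asIdeal.ResidueField = n}.encard ≤ (n ^ s.card : ℕ) := by
  obtain h | ⟨z₀, rfl⟩ :=
    {z : PrimeSpectrum R | Nat.card z.asIdeal.ResidueField = n}.eq_empty_or_nonempty
  · simp [h]
  have : Finite z₀.asIdeal.ResidueField := Nat.finite_of_card_ne_zero hn
  refine le_trans (Set.encard_le_encard ?_) ((Set.encard_image_le
    (fun φ : R →+* z₀.asIdeal.ResidueField => PrimeSpectrum.comap φ ⊥) Set.univ).trans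
    (encard_univ_ringHom_le hs))
  intro z hz
  obtain ⟨φ, hφ⟩ := exists_ringHom_ker_eq z₀.asIdeal.ResidueField z hz
  exact ⟨φ, Set.mem_univ φ, PrimeSpectrum.ext hφ⟩

lemma encard_range_inter_natCard_residueField_eq_le {X : Scheme.{u}} {R : CommRingCat.{u}}
    (i : Spec R ⟶ X) [IsPreimmersion i] {s : Finset R} (hs : Algebra.adjoin ℤ (s : Set R) = ⊤)
    {n : ℕ} (hn : n ≠ 0) :
    (Set.range i ∩ {x : X | Nat.card (X.residueField x) = n}).encard ≤ (n ^ s.card : ℕ) := by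
  let T : Set (PrimeSpectrum R) := {z | Nat.card z.asIdeal.ResidueField = n}
  have hsub : Set.range i ∩ {x : X | Nat.card (X.residueField x) = n} ⊆ i '' T := by
    rintro _ ⟨⟨z, rfl⟩, (hz : Nat.card (X.residueField (i z)) = n)⟩
    rw [natCard_residueField_apply] at hz
    refine ⟨z, ?_, rfl⟩
    exact (natCard_residueField_Spec R z).symm.trans hz
  exact (Set.encard_le_encard hsub).trans
    ((Set.encard_image_le i T).trans (encard_natCard_primeSpectrum_residueField_eq_le hs hn))

lemma exists_encard_natCard_residueField_eq_le {X : Scheme.{0}} (f : X ⟶ Spec (.of ℤ))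
    [LocallyOfFiniteType f] [QuasiCompact f] :
    ∃ C r : ℕ, ∀ n : ℕ, n ≠ 0 →
      {x : X | Nat.card (X.residueField x) = n}.encard ≤ (C * n ^ r : ℕ) := by
  have : CompactSpace X := (quasiCompact_iff_compactSpace (f := f)).mp inferInstance
  let 𝒰 := X.affineCover.finiteSubcover
  have := Fintype.ofFinite 𝒰.I₀
  let g (j : 𝒰.I₀) : Spec Γ(𝒰.X j, ⊤) ⟶ X := (𝒰.X j).isoSpec.inv ≫ 𝒰.f j
  have hcover (x : X) : ∃ j, x ∈ Set.range (g j) := by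
    obtain ⟨y, hy⟩ := 𝒰.covers x
    obtain ⟨z, rfl⟩ := (𝒰.X (𝒰.idx x)).isoSpec.inv.surjective y
    exact ⟨𝒰.idx x, z, hy⟩
  have hgen (j : 𝒰.I₀) :
      ∃ s : Finset Γ(𝒰.X j, ⊤), Algebra.adjoin ℤ (s : Set Γ(𝒰.X j, ⊤)) = ⊤ := by
    obtain ⟨φ, hφ⟩ := Spec.map_surjective (g j ≫ f)
    have hft : φ.hom.FiniteType := by
      rw [← HasRingHomProperty.Spec_iff (P := @LocallyOfFiniteType), hφ]
      infer_instance
    exact (RingHom.finiteType_algebraMap.mp (Subsingleton.elim φ.hom (algebraMap ℤ _) ▸ hft)).out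
  choose s hs using hgen
  refine ⟨Fintype.card 𝒰.I₀, ∑ j, (s j).card, fun n hn => ?_⟩
  let S : Set X := {x | Nat.card (X.residueField x) = n}
  have hle (j : 𝒰.I₀) : (Set.range (g j) ∩ S).encard ≤ (n ^ ∑ j, (s j).card : ℕ) :=
    (encard_range_inter_natCard_residueField_eq_le (g j) (hs j) hn).trans <|
      ENat.natCast_le_natCast.mpr <| Nat.pow_le_pow_right (Nat.pos_of_ne_zero hn) <|
      Finset.single_le_sum (f := fun j => (s j).card) (fun _ _ => Nat.zero_le _)
        (Finset.mem_univ j)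
  calc S.encard ≤ (⋃ j, Set.range (g j) ∩ S).encard :=
        Set.encard_le_encard fun x hx => Set.mem_iUnion.mpr ((hcover x).imp fun _ h => ⟨h, hx⟩)
    _ ≤ ∑ j, (Set.range (g j) ∩ S).encard := Set.encard_iUnion_le_of_fintype _
    _ ≤ ∑ _ : 𝒰.I₀, ((n ^ ∑ j, (s j).card : ℕ) : ℕ∞) := Finset.sum_le_sum fun j _ => hle j
    _ = _ := by simp

end PointCount

section PrimeFibre

lemma natPrime_eq_of_cast_mem {I : Ideal ℤ} (hI : I ≠ ⊤) {p q : Nat.Primes} (hp : (p : ℤ) ∈ I)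
    (hq : (q : ℤ) ∈ I) : p = q := by
  by_contra hne
  have hcoprime : IsCoprime (p : ℤ) (q : ℤ) :=
    Nat.isCoprime_iff_coprime.mpr
      ((Nat.coprime_primes p.2 q.2).mpr fun h => hne (Subtype.ext h))
  obtain ⟨a, b, hab⟩ := hcoprime
  exact hI <| (Ideal.eq_top_iff_one I).mpr <| hab ▸
    I.add_mem (I.mul_mem_left a hp) (I.mul_mem_left b hq)

lemma exists_natPrime_cast_mem {I : Ideal ℤ} (hbot : I ≠ ⊥) (hI : I.IsPrime) :
    ∃ p : Nat.Primes, (p : ℤ) ∈ I := by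
  obtain ⟨g, rfl⟩ := IsPrincipalIdealRing.principal I
  have hg : g ≠ 0 := fun h => hbot (by simp [h])
  have hp := Int.prime_iff_natAbs_prime.mp ((Ideal.span_singleton_prime hg).mp hI)
  exact ⟨⟨_, hp⟩, Ideal.mem_span_singleton.mpr (Int.dvd_natAbs.mpr dvd_rfl)⟩

variable {X : Scheme.{0}} (f : X ⟶ Spec (.of ℤ))

/-- The inclusion `X_p → X` of the fibre over a prime. -/
def primeFibreι (p : Nat.Primes) : primeFibre f p ⟶ X :=
  Limits.pullback.fst f (Spec.map (CommRingCat.ofHom (Int.castRingHom (ZMod p))))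

instance (p : Nat.Primes) : IsClosedImmersion (primeFibreι f p) := by
  have : IsClosedImmersion (Spec.map (CommRingCat.ofHom (Int.castRingHom (ZMod p)))) :=
    IsClosedImmersion.spec_of_surjective _ ZMod.intCast_surjective
  exact inferInstanceAs (IsClosedImmersion (Limits.pullback.fst _ _))

instance [LocallyOfFiniteType f] (p : Nat.Primes) : LocallyOfFiniteType (primeFibreMap f p) :=
  inferInstanceAs (LocallyOfFiniteType (Limits.pullback.snd _ _))

instance [QuasiCompact f] (p : Nat.Primes) : QuasiCompact (primeFibreMap f p) :=
  inferInstanceAs (QuasiCompact (Limits.pullback.snd _ _))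

lemma mem_range_primeFibreι (p : Nat.Primes) (x : X) :
    x ∈ Set.range (primeFibreι f p) ↔ (p : ℤ) ∈ (f x).asIdeal := by
  have hfst := Set.ext_iff.mp (Scheme.Pullback.range_fst f
    (Spec.map (CommRingCat.ofHom (Int.castRingHom (ZMod p))))) x
  have hcomap := range_comap_of_surjective (ZMod p) (Int.castRingHom (ZMod p))
    ZMod.intCast_surjective
  rw [ZMod.ker_intCastRingHom, PrimeSpectrum.zeroLocus_span] at hcomap
  exact hfst.trans ((Set.ext_iff.mp hcomap (f x)).trans Set.singleton_subset_iff)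

variable [LocallyOfFiniteType f]

lemma exists_mem_range_primeFibreι (x : closedPoints X) :
    ∃ p, x.1 ∈ Set.range (primeFibreι f p) := by
  have hclosed : IsClosed {f x.1} := f.closePoints_subset_preimage_closedPoints x.2
  have hmax : (f x.1).asIdeal.IsMaximal :=
    (PrimeSpectrum.isClosed_singleton_iff_isMaximal _).mp hclosed
  obtain ⟨p, hp⟩ := exists_natPrime_cast_mem
    (Ring.ne_bot_of_isMaximal_of_not_isField hmax Int.not_isField) (f x.1).2
  exact ⟨p, (mem_range_primeFibreι f p _).mpr hp⟩

/-- A closed point of a scheme of finite type over `ℤ` lies on the fibre over exactly one prime. -/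
def sigmaPrimeFibreEquiv : (Σ p, closedPoints (primeFibre f p)) ≃ closedPoints X :=
  sigmaClosedPointsEquiv (primeFibre f) (primeFibreι f)
    (fun p q z _ h => natPrime_eq_of_cast_mem (f (primeFibreι f p z.1)).2.ne_top
      ((mem_range_primeFibreι f p _).mp ⟨_, rfl⟩) ((mem_range_primeFibreι f q _).mp ⟨_, h.symm⟩))
    (exists_mem_range_primeFibreι f)

lemma pointNorm_sigmaPrimeFibreEquiv (p : Nat.Primes) (z : closedPoints (primeFibre f p)) :
    pointNorm X (sigmaPrimeFibreEquiv f ⟨p, z⟩) = p ^ pointDegree (primeFibreMap f p) z := by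
  refine (pointNorm_closedPointsMap (primeFibreι f p) z).trans ?_
  rw [pointNorm_eq_card_pow (primeFibreMap f p) z, Nat.card_zmod]

end PrimeFibre

section AffineLine

variable (X : Scheme.{0})

/-- The affine line over an affine scheme as the spectrum of a ring of polynomials in one
variable. -/
def specPolynomialIso (R : CommRingCat.{0}) :
    Spec (.of (Polynomial R)) ≅ affineLine (Spec R) :=
  Scheme.Spec.mapIso
      (MvPolynomial.uniqueAlgEquiv R PUnit).toRingEquiv.toCommRingCatIso.op ≪≫
    (AffineSpace.SpecIso PUnit R).symm

/-- The inclusion of the fibre of `X × 𝔸¹` over a point `x` of `X`, this fibre being the affine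
line over the residue field of `x`. -/
def affineLineFibreι (x : X) : Spec (.of (Polynomial (X.residueField x))) ⟶ affineLine X :=
  (specPolynomialIso (X.residueField x)).hom ≫ AffineSpace.map PUnit (X.fromSpecResidueField x)

instance isClosedImmersion_affineLineFibreι (x : closedPoints X) :
    IsClosedImmersion (affineLineFibreι X x.1) := by
  have := isClosed_singleton_iff_isClosedImmersion.mp x.2
  have : IsClosedImmersion (AffineSpace.map PUnit (X.fromSpecResidueField x.1)) :=
    MorphismProperty.of_isPullback (AffineSpace.isPullback_map _).flip this
  unfold affineLineFibreι
  infer_instance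

lemma range_affineLineFibreι (x : X) :
    Set.range (affineLineFibreι X x) = (affineLine X ↘ X) ⁻¹' {x} := by
  have himage := Scheme.image_preimage_eq_of_isPullback
    (AffineSpace.isPullback_map (n := PUnit) (X.fromSpecResidueField x)).flip Set.univ
  rw [Set.preimage_univ, Set.image_univ, Set.image_univ, Scheme.range_fromSpecResidueField]
    at himage
  exact ((specPolynomialIso (X.residueField x)).hom.surjective.range_comp _).trans himage

lemma affineLineFibreι_over (x : X) (z : Spec (.of (Polynomial (X.residueField x)))) :
    (affineLine X ↘ X) (affineLineFibreι X x z) = x :=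
  (range_affineLineFibreι X x).subset ⟨z, rfl⟩

/-- The closed points of `X × 𝔸¹` are the closed points of the affine lines over the residue
fields of the closed points of `X`. -/
def sigmaAffineLineEquiv [JacobsonSpace X] :
    (Σ x : closedPoints X, closedPoints (Spec (.of (Polynomial (X.residueField x.1))))) ≃
      closedPoints (affineLine X) :=
  sigmaClosedPointsEquiv _ (fun x : closedPoints X => affineLineFibreι X x.1)
    (fun x y z w h => Subtype.ext <| by
      rw [← affineLineFibreι_over X x.1 z.1, h, affineLineFibreι_over])
    (fun y => ⟨⟨_, (affineLine X ↘ X).closePoints_subset_preimage_closedPoints y.2⟩,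
      (range_affineLineFibreι X _).superset rfl⟩)

lemma pointNorm_sigmaAffineLineEquiv [JacobsonSpace X] (x : closedPoints X)
    (z : closedPoints (Spec (.of (Polynomial (X.residueField x.1))))) :
    pointNorm (affineLine X) (sigmaAffineLineEquiv X ⟨x, z⟩) = pointNorm _ z :=
  pointNorm_closedPointsMap (affineLineFibreι X x.1) z

end AffineLine

section MonicIrred

open Polynomial

/-- The monic irreducible polynomials in one variable over a field. -/
abbrev MonicIrred (K : Type*) [Field K] : Type _ := {P : K[X] // P.Monic ∧ Irreducible P}

lemma exists_monicIrred_span_eq {K : Type*} [Field K] (I : Ideal K[X]) (hI : I.IsMaximal) :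
    ∃ P : MonicIrred K, Ideal.span {P.1} = I := by
  have hbot : I ≠ ⊥ := Ring.ne_bot_of_isMaximal_of_not_isField hI (not_isField K)
  obtain ⟨g, rfl⟩ := IsPrincipalIdealRing.principal I
  have hg : g ≠ 0 := fun h => hbot (by simp [h])
  have hirr : Irreducible g := ((Ideal.span_singleton_prime hg).mp hI.isPrime).irreducible
  exact ⟨⟨g * C g.leadingCoeff⁻¹, monic_mul_leadingCoeff_inv hg,
    irreducible_mul_leadingCoeff_inv.mpr hirr⟩, Ideal.span_singleton_mul_right_unit
      (isUnit_C.mpr (inv_ne_zero (leadingCoeff_ne_zero.mpr hg)).isUnit) _⟩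

variable (K : Type u) [Field K]

/-- The closed points of the affine line over a field are the monic irreducible polynomials. -/
def monicIrredEquiv : MonicIrred K ≃ closedPoints (Spec (.of K[X])) :=
  .ofBijective (fun P => ⟨(⟨Ideal.span {P.1}, (Ideal.span_singleton_prime P.2.2.ne_zero).mpr
      P.2.2.prime⟩ : PrimeSpectrum K[X]), (PrimeSpectrum.isClosed_singleton_iff_isMaximal _).mpr
      (PrincipalIdealRing.isMaximal_of_irreducible P.2.2)⟩) <| by
    refine ⟨fun P Q h => ?_, ?_⟩
    · have hspan : Ideal.span {P.1} = Ideal.span {Q.1} :=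
        congrArg (fun z => PrimeSpectrum.asIdeal z.1) h
      exact Subtype.ext (eq_of_monic_of_associated P.2.1 Q.2.1
        (Ideal.span_singleton_eq_span_singleton.mp hspan))
    · rintro ⟨z, hz⟩
      obtain ⟨P, hP⟩ := exists_monicIrred_span_eq z.asIdeal
        ((PrimeSpectrum.isClosed_singleton_iff_isMaximal _).mp hz)
      exact ⟨P, Subtype.ext (PrimeSpectrum.ext hP)⟩

variable {K}

lemma natCard_quotient_span_of_monic {P : K[X]} (hP : P.Monic) :
    Nat.card (K[X] ⧸ Ideal.span {P}) = Nat.card K ^ P.natDegree := by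
  have : Module.Finite K (AdjoinRoot P) := hP.finite_adjoinRoot
  have hcard := Module.natCard_eq_pow_finrank (K := K) (V := AdjoinRoot P)
  rwa [(AdjoinRoot.powerBasis' hP).finrank, AdjoinRoot.powerBasis'_dim] at hcard

lemma pointNorm_monicIrredEquiv {K : Type} [Field K] (P : MonicIrred K) :
    pointNorm _ (monicIrredEquiv K P) = Nat.card K ^ P.1.natDegree := by
  have := (PrimeSpectrum.isClosed_singleton_iff_isMaximal _).mp (monicIrredEquiv K P).2
  exact (natCard_residueField_Spec (.of K[X]) (monicIrredEquiv K P).1).trans <|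
    (natCard_residueField_of_isMaximal _).trans (natCard_quotient_span_of_monic P.2.1)

end MonicIrred

open scoped PowerSeries.WithPiTopology

section WeightedCycles

variable {ι : Type*} {d : ι → ℕ}

lemma support_pointwise_smul (hd : ∀ x, d x ≠ 0) (α : ι →₀ ℕ) :
    (d • α).support = α.support := by
  ext x
  simp [hd x]

lemma pointwise_smul_injective (hd : ∀ x, d x ≠ 0) :
    Function.Injective fun α : ι →₀ ℕ => d • α := fun α β h => by
  ext x
  exact Nat.eq_of_mul_eq_mul_left (Nat.pos_of_ne_zero (hd x)) (DFunLike.congr_fun h x)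

lemma exists_pointwise_smul_eq {l : ι →₀ ℕ} (hl : ∀ x, d x ∣ l x) : ∃ α : ι →₀ ℕ, d • α = l := by
  refine ⟨Finsupp.onFinset l.support (fun x => l x / d x) fun x hx => ?_, ?_⟩
  · exact Finsupp.mem_support_iff.mpr fun h => hx (by rw [h, Nat.zero_div])
  · ext x
    exact Nat.mul_div_cancel' (hl x)

lemma pointwise_smul_mem_finsuppAntidiag [DecidableEq ι] (hd : ∀ x, d x ≠ 0) {α : ι →₀ ℕ}
    {S : Finset ι} {n : ℕ} :
    d • α ∈ S.finsuppAntidiag n ↔ Finsupp.weight d α = n ∧ α.support ⊆ S := by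
  rw [Finset.mem_finsuppAntidiag, support_pointwise_smul hd]
  refine and_congr_left fun hS => ?_
  rw [Finsupp.weight_apply, Finsupp.sum_of_support_subset α hS (fun x a => a • d x)
    fun _ _ => zero_smul ℕ _]
  simp only [smul_eq_mul, mul_comm]
  rfl

lemma support_subset_of_weight_le {α : ι →₀ ℕ} {n : ℕ} (hα : Finsupp.weight d α ≤ n)
    {S : Finset ι} (hS : ∀ x, d x ≤ n → x ∈ S) : α.support ⊆ S := fun x hx =>
  hS x <| (Finsupp.le_weight_of_ne_zero' d (Finsupp.mem_support_iff.mp hx)).trans hα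

lemma finite_setOf_weight_eq [Northcott d] (hd : ∀ x, d x ≠ 0) (n : ℕ) :
    {α : ι →₀ ℕ | Finsupp.weight d α = n}.Finite := by
  classical
  let S := (Northcott.finite_le (h := d) n).toFinset
  have hS : ∀ x, d x ≤ n → x ∈ S := fun x hx => by simpa [S] using hx
  refine .of_finite_image ((S.finsuppAntidiag n).finite_toSet.subset ?_)
    (pointwise_smul_injective hd).injOn
  rintro _ ⟨α, hα, rfl⟩
  exact (pointwise_smul_mem_finsuppAntidiag hd).mpr ⟨hα, support_subset_of_weight_le hα.le hS⟩

variable {R : Type*} [CommRing R]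

/-- The generating series `∑_α (∏ₓ c x (α x)) t ^ (∑ₓ α x * d x)` of finitely supported
functions `α : ι →₀ ℕ`. It is meaningful when finitely many `α` have any given weight. -/
def cycleSeries (d : ι → ℕ) (c : ι → ℕ → R) : PowerSeries R :=
  .mk fun n => ∑ᶠ α ∈ {α : ι →₀ ℕ | Finsupp.weight d α = n}, α.prod c

lemma coeff_pointwise_smul_expand (hd : ∀ x, d x ≠ 0) (c : ι → ℕ → R) (α : ι →₀ ℕ) (x : ι) :
    PowerSeries.coeff ((d • α) x) (PowerSeries.expand (d x) (hd x) (.mk (c x))) = c x (α x) := by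
  rw [Finsupp.coe_pointwise_smul, Pi.smul_apply', smul_eq_mul, PowerSeries.coeff_expand_mul,
    PowerSeries.coeff_mk]

lemma coeff_prod_expand [Northcott d] (hd : ∀ x, d x ≠ 0) {c : ι → ℕ → R}
    (hc : ∀ x, c x 0 = 1) {n : ℕ} {S : Finset ι} (hS : ∀ x, d x ≤ n → x ∈ S) :
    PowerSeries.coeff n (∏ x ∈ S, PowerSeries.expand (d x) (hd x) (.mk (c x))) =
      PowerSeries.coeff n (cycleSeries d c) := by
  classical
  rw [PowerSeries.coeff_prod, cycleSeries, PowerSeries.coeff_mk,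
    finsum_mem_eq_finite_toFinset_sum _ (finite_setOf_weight_eq hd n)]
  have hsupport {α : ι →₀ ℕ} (hα : α ∈ (finite_setOf_weight_eq hd n).toFinset) :
      Finsupp.weight d α = n ∧ α.support ⊆ S := by
    rw [Set.Finite.mem_toFinset] at hα
    exact ⟨hα, support_subset_of_weight_le (Eq.le hα) hS⟩
  symm
  refine Finset.sum_of_injOn (d • ·) (pointwise_smul_injective hd).injOn
    (fun α hα => (pointwise_smul_mem_finsuppAntidiag hd).mpr (hsupport hα)) ?_ fun α hα => ?_
  · intro l hl hl'
    obtain ⟨x, hx⟩ : ∃ x, ¬ d x ∣ l x := by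
      by_contra! h
      obtain ⟨α, rfl⟩ := exists_pointwise_smul_eq h
      refine hl' ⟨α, ?_, rfl⟩
      simpa using ((pointwise_smul_mem_finsuppAntidiag hd).mp hl).1
    have hxS : x ∈ S := (Finset.mem_finsuppAntidiag.mp hl).2 <|
      Finsupp.mem_support_iff.mpr fun h => hx (h ▸ dvd_zero _)
    exact Finset.prod_eq_zero hxS (by rw [PowerSeries.coeff_expand, if_neg hx])
  · simp only [coeff_pointwise_smul_expand hd]
    exact Finsupp.prod_of_support_subset α (hsupport hα).2 c fun x _ => hc x

lemma hasProd_iff_eventually_coeff [TopologicalSpace R] [DiscreteTopology R]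
    {F : ι → PowerSeries R} {G : PowerSeries R} :
    HasProd F G ↔ ∀ n, ∀ᶠ S : Finset ι in atTop,
      PowerSeries.coeff n (∏ x ∈ S, F x) = PowerSeries.coeff n G := by
  rw [HasProd, SummationFilter.unconditional_filter,
    PowerSeries.WithPiTopology.tendsto_iff_coeff_tendsto]
  simp only [nhds_discrete, tendsto_pure]

lemma hasProd_cycleSeries [TopologicalSpace R] [DiscreteTopology R] [Northcott d]
    (hd : ∀ x, d x ≠ 0) {c : ι → ℕ → R} (hc : ∀ x, c x 0 = 1) :
    HasProd (fun x => PowerSeries.expand (d x) (hd x) (.mk (c x))) (cycleSeries d c) := by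
  rw [hasProd_iff_eventually_coeff]
  intro n
  filter_upwards [eventually_ge_atTop (Northcott.finite_le (h := d) n).toFinset] with S hS
  exact coeff_prod_expand hd hc fun x hx => hS (by simpa using hx)

end WeightedCycles

section Continuity

variable {R : Type*} [CommRing R] [TopologicalSpace R] [DiscreteTopology R]

lemma continuous_of_coeff {φ : PowerSeries R → PowerSeries R}
    (h : ∀ n, ∃ m, ∃ c : R → R, ∀ F, PowerSeries.coeff n (φ F) = c (PowerSeries.coeff m F)) :
    Continuous φ := by
  refine continuous_iff_continuousAt.mpr fun F =>
    (PowerSeries.WithPiTopology.tendsto_iff_coeff_tendsto R _ _ _).mpr fun n => ?_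
  obtain ⟨m, c, hc⟩ := h n
  simp_rw [hc]
  exact ((continuous_of_discreteTopology (f := c)).comp
    (PowerSeries.WithPiTopology.continuous_coeff R m)).continuousAt

lemma continuous_expand {d : ℕ} (hd : d ≠ 0) : Continuous (PowerSeries.expand (R := R) d hd) :=
  continuous_of_coeff fun n =>
    ⟨n / d, fun a => if d ∣ n then a else 0, fun F => PowerSeries.coeff_expand d hd F⟩

lemma continuous_rescale (q : R) : Continuous (PowerSeries.rescale q) :=
  continuous_of_coeff fun n => ⟨n, fun a => q ^ n * a, fun _ => PowerSeries.coeff_rescale _ _ _⟩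

end Continuity

section GeometricSeries

open PowerSeries

section CommRing

variable {R : Type*} [CommRing R]

lemma mk_pow_eq_rescale (c : R) : mk (fun n => c ^ n) = rescale c (mk 1) := by
  ext n
  simp

lemma mk_pow_mul_one_sub (c : R) : mk (fun n => c ^ n) * (1 - C c * X) = 1 := by
  simpa [mk_pow_eq_rescale] using congrArg (rescale c) (mk_one_mul_one_sub_eq_one R)

lemma expand_mk_one_mul_one_sub {d : ℕ} (hd : d ≠ 0) :
    expand d hd (mk 1) * (1 - X ^ d) = (1 : PowerSeries R) := by
  simpa using congrArg (expand d hd) (mk_one_mul_one_sub_eq_one R)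

lemma rescale_expand_mk_one (q : R) {d : ℕ} (hd : d ≠ 0) :
    rescale q (expand d hd (mk 1)) = expand d hd (mk fun a => (q ^ d) ^ a) := by
  ext n
  rw [coeff_rescale, coeff_expand, coeff_expand]
  split_ifs with h
  · obtain ⟨m, rfl⟩ := h
    simp [Nat.mul_div_cancel_left _ (Nat.pos_of_ne_zero hd), pow_mul]
  · exact mul_zero _

lemma expand_comm {d e : ℕ} (hd : d ≠ 0) (he : e ≠ 0) (F : PowerSeries R) :
    expand d hd (expand e he F) = expand e he (expand d hd F) := by
  simp only [← expand_mul, mul_comm d e]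

end CommRing

variable {K : Type*} [Field K]

/-- The contribution of `a • x` to `ψ` when `N` is the norm of the closed point `x`: it equals
`N ^ a * (1 + N⁻¹)` for `a ≠ 0`, and `1` for `a = 0`. -/
def psiCoeff (N : K) (a : ℕ) : K := if a = 0 then 1 else N ^ a * (1 + N⁻¹)

lemma psiCoeff_zero (N : K) : psiCoeff N 0 = 1 := if_pos rfl

lemma psiCoeff_succ {N : K} (hN : N ≠ 0) (a : ℕ) :
    psiCoeff N (a + 1) = N ^ (a + 1) + N ^ a := by
  rw [psiCoeff, if_neg a.succ_ne_zero]
  field_simp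
  ring

lemma mk_psiCoeff_mul_one_sub {N : K} (hN : N ≠ 0) :
    mk (psiCoeff N) * (1 - C N * X) = 1 + X := by
  ext n
  rw [mul_sub, mul_one, mul_comm (C N), ← mul_assoc, map_sub, coeff_mul_C]
  rcases n with _ | _ | n
  · simp [psiCoeff_zero]
  · simp [psiCoeff_zero, psiCoeff_succ hN, coeff_succ_mul_X, coeff_one]
  · simp [psiCoeff_succ hN, coeff_succ_mul_X, coeff_one, coeff_X]
    ring

lemma mk_psiCoeff_mul_expand {N : K} (hN : N ≠ 0) :
    mk (psiCoeff N) * expand 2 two_ne_zero (mk 1) = mk 1 * mk (fun a => N ^ a) := by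
  have hψ := mk_psiCoeff_mul_one_sub hN
  have hsq := expand_mk_one_mul_one_sub (R := K) two_ne_zero
  have hone := mk_one_mul_one_sub_eq_one K
  have hN' := mk_pow_mul_one_sub N
  set ψ := mk (psiCoeff N)
  set B : PowerSeries K := expand 2 two_ne_zero (mk 1)
  set E : PowerSeries K := mk 1
  set D := mk fun a => N ^ a
  linear_combination (-(ψ * B * D) * (1 - C N * X)) * hone - (ψ * B) * hN' +
    E * D * B * (1 - X) * hψ + E * D * hsq

lemma inv_one_sub_X : (1 - X : PowerSeries K)⁻¹ = mk 1 := by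
  rw [PowerSeries.inv_eq_iff_mul_eq_one (by simp)]
  exact mk_one_mul_one_sub_eq_one K

lemma inv_one_sub_X_pow {d : ℕ} (hd : d ≠ 0) :
    (1 - X ^ d : PowerSeries K)⁻¹ = expand d hd (mk 1) := by
  rw [PowerSeries.inv_eq_iff_mul_eq_one (by simp [hd])]
  exact expand_mk_one_mul_one_sub hd

lemma cycleSeries_psiCoeff_mul_expand [TopologicalSpace K] [DiscreteTopology K] {ι : Type*}
    {d : ι → ℕ} [Northcott d] (hd : ∀ x, d x ≠ 0) {q : K} (hq : q ≠ 0) {Z : PowerSeries K}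
    (hZ : HasProd (fun x => expand (d x) (hd x) (mk 1)) Z) :
    cycleSeries d (fun x => psiCoeff (q ^ d x)) * expand 2 two_ne_zero Z = Z * rescale q Z := by
  have hψ := hasProd_cycleSeries hd (c := fun x => psiCoeff (q ^ d x)) fun x => psiCoeff_zero _
  have hsq := hZ.map (expand 2 two_ne_zero) (continuous_expand two_ne_zero)
  have hrescale := hZ.map (rescale q) (continuous_rescale q)
  refine (hψ.mul hsq).unique ?_
  convert! hZ.mul hrescale using 2 with x
  rw [Function.comp_apply, Function.comp_apply, expand_comm, rescale_expand_mk_one, ← map_mul,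
    ← map_mul, mk_psiCoeff_mul_expand (pow_ne_zero _ hq)]

end GeometricSeries

section MonicPolynomials

open Polynomial UniqueFactorizationMonoid

variable {K : Type*} [Field K]

lemma MonicIrred.natDegree_ne_zero (P : MonicIrred K) : P.1.natDegree ≠ 0 :=
  P.2.2.natDegree_pos.ne'

/-- The monic polynomial with the factorization `α` into monic irreducible polynomials. -/
def monicProd (α : MonicIrred K →₀ ℕ) : K[X] := α.prod fun P a => P.1 ^ a

lemma monic_monicProd (α : MonicIrred K →₀ ℕ) : (monicProd α).Monic :=
  monic_prod_of_monic _ _ fun P _ => P.2.1.pow _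

lemma natDegree_monicProd (α : MonicIrred K →₀ ℕ) :
    (monicProd α).natDegree = Finsupp.weight (fun P : MonicIrred K => P.1.natDegree) α := by
  rw [monicProd, Finsupp.prod, natDegree_prod_of_monic _ _ fun P _ => P.2.1.pow _,
    Finsupp.weight_apply]
  exact Finset.sum_congr rfl fun P _ => P.2.1.natDegree_pow _

lemma monicProd_eq_multisetProd (α : MonicIrred K →₀ ℕ) :
    monicProd α = ((Finsupp.toMultiset α).map Subtype.val).prod := by
  rw [Finsupp.toMultiset_map, Finsupp.prod_toMultiset]
  exact (Finsupp.prod_mapDomain_index (h := fun (P : K[X]) a => P ^ a) (fun P => pow_zero P)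
    fun P => pow_add P).symm

lemma normalizedFactors_monicProd [DecidableEq K] (α : MonicIrred K →₀ ℕ) :
    normalizedFactors (monicProd α) = (Finsupp.toMultiset α).map Subtype.val := by
  rw [monicProd_eq_multisetProd, normalizedFactors_prod_eq, Multiset.map_map]
  · exact Multiset.map_congr rfl fun P _ => P.2.1.normalize_eq_self
  · intro P hP
    obtain ⟨P, -, rfl⟩ := Multiset.mem_map.mp hP
    exact P.2.2

lemma monicProd_injective : Function.Injective (monicProd (K := K)) := by
  classical
  intro α β h
  refine Multiset.toFinsupp.symm.injective (Multiset.map_injective Subtype.val_injective ?_)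
  exact (normalizedFactors_monicProd α).symm.trans (h ▸ normalizedFactors_monicProd β)

lemma exists_monicProd_eq {f : K[X]} (hf : f.Monic) : ∃ α, monicProd α = f := by
  classical
  obtain ⟨s, hs⟩ : ∃ s : Multiset (MonicIrred K), s.map Subtype.val = normalizedFactors f :=
    CanLift.prf _ fun P hP =>
      have hP := (Polynomial.mem_normalizedFactors_iff hf.ne_zero).mp hP
      ⟨hP.2.1, hP.1⟩
  refine ⟨Multiset.toFinsupp s, ?_⟩
  rw [monicProd_eq_multisetProd, Multiset.toFinsupp_toMultiset, hs]
  simpa only [hf.leadingCoeff, C_1, one_mul] using leadingCoeff_mul_prod_normalizedFactors f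

/-- Unique factorization of monic polynomials over a field, as a bijection. -/
def factorizationEquiv : (MonicIrred K →₀ ℕ) ≃ {f : K[X] // f.Monic} :=
  .ofBijective (fun α => ⟨monicProd α, monic_monicProd α⟩)
    ⟨fun _ _ h => monicProd_injective (congrArg Subtype.val h), fun f =>
      (exists_monicProd_eq f.2).imp fun _ h => Subtype.ext h⟩

variable (K) in
/-- Factorizations of total degree `n` correspond to monic polynomials of degree `n`, which are
given by their `n` lower coefficients. -/
def factorizationWeightEquiv (n : ℕ) :
    {α : MonicIrred K →₀ ℕ // Finsupp.weight (·.1.natDegree) α = n} ≃ (Fin n → K) :=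
  ((factorizationEquiv.subtypeEquiv fun α => by rw [← natDegree_monicProd]; rfl).trans
    (Equiv.subtypeSubtypeEquivSubtypeInter Monic fun f : K[X] => f.natDegree = n)).trans
  ((monicEquivDegreeLT n).trans (degreeLTEquiv K n).toEquiv)

lemma natCard_setOf_weight_natDegree_eq (n : ℕ) :
    Nat.card {α : MonicIrred K →₀ ℕ // Finsupp.weight (·.1.natDegree) α = n} =
      Nat.card K ^ n := by
  rw [Nat.card_congr (factorizationWeightEquiv K n), Nat.card_fun, Nat.card_fin]

instance [Finite K] : Northcott fun P : MonicIrred K => P.1.natDegree where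
  finite_le n := by
    have : Finite (degreeLT K (n + 1)) := .of_equiv _ (degreeLTEquiv K (n + 1)).symm.toEquiv
    refine ((degreeLT K (n + 1) : Set K[X]).toFinite.preimage
      Subtype.val_injective.injOn).subset fun P hP => mem_degreeLT.mpr ?_
    exact degree_le_natDegree.trans_lt (Nat.cast_lt.mpr (Nat.lt_succ_of_le hP))

lemma hasProd_expand_natDegree [Finite K] {R : Type*} [CommRing R] [TopologicalSpace R]
    [DiscreteTopology R] :
    HasProd (fun P : MonicIrred K =>
        PowerSeries.expand P.1.natDegree P.natDegree_ne_zero (.mk 1 : PowerSeries R))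
      (.mk fun n => (Nat.card K : R) ^ n) := by
  convert! hasProd_cycleSeries (R := R) (MonicIrred.natDegree_ne_zero (K := K))
    (c := fun _ _ => 1) (fun _ => rfl) using 1
  ext n
  rw [cycleSeries, PowerSeries.coeff_mk, PowerSeries.coeff_mk,
    finsum_mem_eq_finite_toFinset_sum _ (finite_setOf_weight_eq MonicIrred.natDegree_ne_zero n)]
  simp only [Finsupp.prod, Finset.prod_const_one]
  rw [Finset.sum_const, nsmul_one, ← Nat.card_eq_card_finite_toFinset, ← Nat.cast_pow,
    ← natCard_setOf_weight_natDegree_eq]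
  rfl

end MonicPolynomials

section PrimePart

variable {R : Type*} [CommRing R]

open ArithmeticFunction

/-- The Euler factor `∑ F(p ^ n) X ^ n` of an arithmetic function at a prime `p`, as a ring
homomorphism. It turns identities between multiplicative functions into local identities. -/
def primePart (p : Nat.Primes) : ArithmeticFunction R →+* PowerSeries R where
  toFun F := PowerSeries.mk fun n => F (p.1 ^ n)
  map_zero' := by ext; simp
  map_add' F G := by ext; simp
  map_one' := by
    ext n
    simp [PowerSeries.coeff_one, one_apply, p.2.ne_one]
  map_mul' F G := by
    ext n
    rw [PowerSeries.coeff_mk, PowerSeries.coeff_mul, mul_apply]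
    simp_rw [PowerSeries.coeff_mk]
    rw [Nat.sum_divisorsAntidiagonal (fun a b => F a * G b), Nat.sum_divisors_prime_pow p.2,
      Finset.Nat.sum_antidiagonal_eq_sum_range_succ (fun a b => F (p.1 ^ a) * G (p.1 ^ b))]
    refine Finset.sum_congr rfl fun k hk => ?_
    rw [Nat.pow_div (Nat.lt_succ_iff.mp (Finset.mem_range.mp hk)) p.2.pos]

lemma coeff_primePart (p : Nat.Primes) (F : ArithmeticFunction R) (n : ℕ) :
    PowerSeries.coeff n (primePart p F) = F (p.1 ^ n) :=
  PowerSeries.coeff_mk n fun n => F (p.1 ^ n)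

lemma primePart_ofPowerSeries_self (p : Nat.Primes) (F : PowerSeries R) :
    primePart p (ofPowerSeries p.1 F) = F := by
  ext n
  rw [coeff_primePart, ofPowerSeries_apply_pow p.2.one_lt]

lemma primePart_ofPowerSeries_pow (p : Nat.Primes) {d : ℕ} (hd : d ≠ 0) (F : PowerSeries R) :
    primePart p (ofPowerSeries (p.1 ^ d) F) = PowerSeries.expand d hd F := by
  rw [ofPowerSeries_pow _ hd, primePart_ofPowerSeries_self, PowerSeries.expand_apply]

lemma primePart_ofPowerSeries_of_ne {p p' : Nat.Primes} (h : p' ≠ p) {d : ℕ} (hd : d ≠ 0)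
    {F : PowerSeries R} (hF : F.constantCoeff = 1) :
    primePart p (ofPowerSeries (p'.1 ^ d) F) = 1 := by
  ext n
  rw [coeff_primePart, PowerSeries.coeff_one]
  split_ifs with hn
  · rw [hn, pow_zero, ofPowerSeries_apply_one, hF]
  · rw [ofPowerSeries_apply (Nat.one_lt_pow hd p'.2.one_lt), Function.extend_apply']
    · rfl
    · rintro ⟨k, hk⟩
      have hdvd : p.1 ∣ (p'.1 ^ d) ^ k := hk ▸ dvd_pow_self _ hn
      exact h (Subtype.ext ((Nat.prime_dvd_prime_iff_eq p.2 p'.2).mp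
        (p.2.dvd_of_dvd_pow (p.2.dvd_of_dvd_pow hdvd))).symm)

lemma hasProd_primePart [TopologicalSpace R] [DiscreteTopology R] {ι : Type*}
    {F : ι → ArithmeticFunction R} {G : ArithmeticFunction R}
    (h : ∀ n, ∀ᶠ S : Finset ι in atTop, (∏ x ∈ S, F x) n = G n) (p : Nat.Primes) :
    HasProd (fun x => primePart p (F x)) (primePart p G) := by
  rw [hasProd_iff_eventually_coeff]
  intro n
  filter_upwards [h (p.1 ^ n)] with S hS
  rw [← map_prod, coeff_primePart, hS, coeff_primePart]

lemma atTwoS_apply_sq (F : ArithmeticFunction ℚ) (n : ℕ) : atTwoS F (n * n) = F n := by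
  change (if IsSquare (n * n) then F (n * n).sqrt else 0) = F n
  rw [if_pos ⟨n, rfl⟩, Nat.sqrt_eq]

lemma atTwoS_apply_of_not_isSquare (F : ArithmeticFunction ℚ) {n : ℕ} (h : ¬ IsSquare n) :
    atTwoS F n = 0 := by
  change (if IsSquare n then F n.sqrt else 0) = 0
  rw [if_neg h]

lemma primePart_atTwoS (p : Nat.Primes) (F : ArithmeticFunction ℚ) :
    primePart p (atTwoS F) = PowerSeries.expand 2 two_ne_zero (primePart p F) := by
  ext n
  rw [coeff_primePart, PowerSeries.coeff_expand]
  split_ifs with h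
  · obtain ⟨m, rfl⟩ := h
    rw [coeff_primePart, Nat.mul_div_cancel_left _ two_pos, two_mul, pow_add, atTwoS_apply_sq]
  · refine atTwoS_apply_of_not_isSquare F fun hsq => h ?_
    rw [← even_iff_two_dvd]
    obtain ⟨a, ha⟩ := hsq
    obtain ⟨i, -, rfl⟩ := (Nat.dvd_prime_pow p.2).mp (Dvd.intro _ ha.symm)
    rw [← pow_add] at ha
    exact ⟨i, Nat.pow_right_injective p.2.two_le ha⟩

lemma isSquare_of_coprime_mul {m n : ℕ} (h : m.Coprime n) (hs : IsSquare (m * n)) :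
    IsSquare m := by
  obtain ⟨c, hc⟩ := hs
  obtain ⟨d, hd⟩ := exists_eq_pow_of_mul_eq_pow (a := m) (b := n) (c := c) (k := 2)
    (Nat.isUnit_iff.mpr h) (by rw [hc, sq])
  exact ⟨d, by rw [hd, sq]⟩

lemma isMultiplicative_atTwoS {F : ArithmeticFunction ℚ} (hF : F.IsMultiplicative) :
    (atTwoS F).IsMultiplicative := by
  refine ⟨?_, fun {m n} hmn => ?_⟩
  · rw [← one_mul 1, atTwoS_apply_sq, hF.1]
  · by_cases hm : IsSquare m
    · by_cases hn : IsSquare n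
      · obtain ⟨a, rfl⟩ := hm
        obtain ⟨b, rfl⟩ := hn
        have hab : a.Coprime b :=
          Nat.Coprime.coprime_mul_left (Nat.Coprime.coprime_mul_left_right hmn)
        rw [mul_mul_mul_comm, atTwoS_apply_sq, atTwoS_apply_sq, atTwoS_apply_sq, hF.2 hab]
      · rw [atTwoS_apply_of_not_isSquare F hn, mul_zero, atTwoS_apply_of_not_isSquare]
        exact fun h => hn (isSquare_of_coprime_mul hmn.symm (mul_comm m n ▸ h))
    · rw [atTwoS_apply_of_not_isSquare F hm, zero_mul, atTwoS_apply_of_not_isSquare]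
      exact fun h => hm (isSquare_of_coprime_mul hmn h)

end PrimePart

section Northcott

variable {X : Scheme.{0}}

lemma one_lt_pointNorm (f : X ⟶ Spec (.of ℤ)) [LocallyOfFiniteType f] (x : closedPoints X) :
    1 < pointNorm X x :=
  have := finite_residueField_of_int f x
  Finite.one_lt_card

lemma exists_encard_pointNorm_eq_le (f : X ⟶ Spec (.of ℤ)) [LocallyOfFiniteType f]
    [QuasiCompact f] :
    ∃ C r : ℕ, ∀ n ≠ 0, {x | pointNorm X x = n}.encard ≤ (C * n ^ r : ℕ) := by
  obtain ⟨C, r, h⟩ := exists_encard_natCard_residueField_eq_le f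
  refine ⟨C, r, fun n hn => le_trans ?_ (h n hn)⟩
  exact Set.encard_preimage_val_le_encard_right (closedPoints X) _

lemma northcott_pointNorm (f : X ⟶ Spec (.of ℤ)) [LocallyOfFiniteType f] [QuasiCompact f] :
    Northcott (pointNorm X) where
  finite_le b := by
    obtain ⟨C, r, h⟩ := exists_encard_pointNorm_eq_le f
    refine ((Set.finite_Icc 1 b).biUnion (t := fun n => {x | pointNorm X x = n})
      fun n hn => Set.finite_of_encard_le_coe (h n (Nat.one_le_iff_ne_zero.mp hn.1))).subset
      fun x hx => ?_
    exact Set.mem_biUnion ⟨(one_lt_pointNorm f x).le, hx⟩ rfl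

end Northcott

section Local

variable {k : Type} [Field k] {X : Scheme.{0}} (f : X ⟶ Spec (.of k))

lemma psi_eq_prod_psiCoeff (α : EffZeroCycle X) :
    psi f α = α.prod fun x => psiCoeff ((Nat.card k : ℚ) ^ pointDegree f x) := by
  rw [psi, cycleDegree, Finsupp.sum, ← Finset.prod_pow_eq_pow_sum, ← Finset.prod_mul_distrib]
  refine Finset.prod_congr rfl fun x hx => ?_
  rw [zpow_neg, zpow_natCast, mul_comm (α x), pow_mul]
  exact (if_neg (Finsupp.mem_support_iff.mp hx)).symm

lemma psiSeries_eq_cycleSeries :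
    psiSeries f =
      cycleSeries (pointDegree f) fun x => psiCoeff ((Nat.card k : ℚ) ^ pointDegree f x) := by
  simp only [psiSeries, psi_eq_prod_psiCoeff]
  rfl

variable [Finite k] [LocallyOfFiniteType f]

lemma pointDegree_ne_zero (x : closedPoints X) : pointDegree f x ≠ 0 :=
  (pointDegree_pos f x).ne'

lemma hasseWeilFactor_eq (x : closedPoints X) :
    hasseWeilFactor f x = PowerSeries.expand _ (pointDegree_ne_zero f x) (PowerSeries.mk 1) :=
  inv_one_sub_X_pow _

variable [QuasiCompact f]

instance : Northcott (pointDegree f) where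
  finite_le n := by
    let g : Spec (.of k) ⟶ Spec (.of ℤ) := Spec.map (CommRingCat.ofHom (Int.castRingHom k))
    have : LocallyOfFiniteType g := by
      rw [HasRingHomProperty.Spec_iff (P := @LocallyOfFiniteType)]
      exact RingHom.FiniteType.of_finite
        (RingHom.finite_algebraMap.mpr (inferInstanceAs (Module.Finite ℤ k)))
    refine ((northcott_pointNorm (f ≫ g)).finite_le (Nat.card k ^ n)).subset fun x hx => ?_
    exact (pointNorm_eq_card_pow f x).trans_le (Nat.pow_le_pow_right Nat.card_pos hx)

lemma finite_setOf_cycleDegree_eq (n : ℕ) : {α : EffZeroCycle X | cycleDegree f α = n}.Finite :=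
  finite_setOf_weight_eq (pointDegree_ne_zero f) n

lemma hasProd_hasseWeilFactor :
    letI : TopologicalSpace ℚ := ⊥
    HasProd (hasseWeilFactor f) (hasseWeilZeta f) := by
  let _ : TopologicalSpace ℚ := ⊥
  have : DiscreteTopology ℚ := ⟨rfl⟩
  have h := hasProd_cycleSeries (R := ℚ) (pointDegree_ne_zero f) (c := fun _ => 1) fun _ => rfl
  rw [← funext (hasseWeilFactor_eq f)] at h
  exact h.multipliable.hasProd

lemma eventually_coeff_prod_hasseWeilFactor (n : ℕ) :
    ∀ᶠ S : Finset (closedPoints X) in atTop,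
      PowerSeries.coeff n (∏ x ∈ S, hasseWeilFactor f x) =
        PowerSeries.coeff n (hasseWeilZeta f) := by
  let _ : TopologicalSpace ℚ := ⊥
  have : DiscreteTopology ℚ := ⟨rfl⟩
  exact hasProd_iff_eventually_coeff.mp (hasProd_hasseWeilFactor f) n

lemma constantCoeff_hasseWeilZeta : PowerSeries.constantCoeff (hasseWeilZeta f) = 1 := by
  obtain ⟨S, hS⟩ := (eventually_coeff_prod_hasseWeilFactor f 0).exists
  rw [PowerSeries.coeff_zero_eq_constantCoeff_apply,
    PowerSeries.coeff_zero_eq_constantCoeff_apply] at hS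
  rw [← hS, map_prod]
  refine Finset.prod_eq_one fun x _ => ?_
  simp [hasseWeilFactor, pointDegree_ne_zero f x]

lemma psiSeries_mul_expand :
    psiSeries f * PowerSeries.expand 2 two_ne_zero (hasseWeilZeta f) =
      hasseWeilZeta f * PowerSeries.rescale (Nat.card k : ℚ) (hasseWeilZeta f) := by
  let _ : TopologicalSpace ℚ := ⊥
  have : DiscreteTopology ℚ := ⟨rfl⟩
  have hZ := hasProd_hasseWeilFactor f
  rw [funext (hasseWeilFactor_eq f)] at hZ
  rw [psiSeries_eq_cycleSeries]
  exact cycleSeries_psiCoeff_mul_expand _ (Nat.cast_ne_zero.mpr Nat.card_pos.ne') hZ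

lemma psiSeries_eq :
    psiSeries f = hasseWeilZeta f * PowerSeries.rescale (Nat.card k : ℚ) (hasseWeilZeta f) *
      (PowerSeries.expand 2 two_ne_zero (hasseWeilZeta f))⁻¹ := by
  rw [PowerSeries.eq_mul_inv_iff_mul_eq]
  · exact psiSeries_mul_expand f
  · rw [PowerSeries.constantCoeff_expand, constantCoeff_hasseWeilZeta]
    exact one_ne_zero

lemma constantCoeff_psiSeries : PowerSeries.constantCoeff (psiSeries f) = 1 := by
  simpa [constantCoeff_hasseWeilZeta, PowerSeries.constantCoeff_expand,
    ← PowerSeries.coeff_zero_eq_constantCoeff_apply (PowerSeries.rescale _ _)]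
    using congrArg PowerSeries.constantCoeff (psiSeries_mul_expand f)

end Local

section FormalDirichlet

open ArithmeticFunction

variable {X : Scheme.{0}} (f : X ⟶ Spec (.of ℤ)) [LocallyOfFiniteType f]

instance : Northcott fun p : Nat.Primes => (p : ℕ) where
  finite_le b := (Set.finite_Iic b).preimage Subtype.val_injective.injOn

include f in
lemma exists_pointNorm_eq_prime_pow (x : closedPoints X) :
    ∃ (p : Nat.Primes) (d : ℕ), d ≠ 0 ∧ pointNorm X x = p.1 ^ d := by
  obtain ⟨⟨p, z⟩, rfl⟩ := (sigmaPrimeFibreEquiv f).surjective x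
  exact ⟨p, _, pointDegree_ne_zero (primeFibreMap f p) z, pointNorm_sigmaPrimeFibreEquiv f p z⟩

include f in
lemma isMultiplicative_formalZeta : (formalZeta X).IsMultiplicative := by
  refine isMultiplicative_eulerProduct _ fun x => ?_
  obtain ⟨p, d, hd, hN⟩ := exists_pointNorm_eq_prime_pow f x
  exact isMultiplicative_ofPowerSeries_of_isPrimePow _ (hN ▸ p.2.isPrimePow.pow hd) _ (by simp)

include f in
lemma isUnit_atTwoS_formalZeta : IsUnit (atTwoS (formalZeta X)) := by
  rw [isUnit_iff_isUnit_apply_one, (isMultiplicative_atTwoS (isMultiplicative_formalZeta f)).1]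
  exact isUnit_one

lemma hasProd_primeFibre_iff {M : Type*} [CommMonoid M] [TopologicalSpace M] (p : Nat.Primes)
    {F : closedPoints X → M} {a : M}
    (hF : ∀ (p' : Nat.Primes) (z : closedPoints (primeFibre f p')), p' ≠ p →
      F (sigmaPrimeFibreEquiv f ⟨p', z⟩) = 1) :
    HasProd (fun z => F (sigmaPrimeFibreEquiv f ⟨p, z⟩)) a ↔ HasProd F a := by
  refine Function.Injective.hasProd_iff (g := fun z => sigmaPrimeFibreEquiv f ⟨p, z⟩)
    ((sigmaPrimeFibreEquiv f).injective.comp sigma_mk_injective) fun x hx => ?_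
  obtain ⟨⟨p', z⟩, rfl⟩ := (sigmaPrimeFibreEquiv f).surjective x
  refine hF p' z fun h => hx ?_
  subst h
  exact ⟨z, rfl⟩

variable [QuasiCompact f]

include f in
lemma eventually_prod_zetaFactor (n : ℕ) :
    ∀ᶠ S : Finset (closedPoints X) in atTop, (∏ x ∈ S, zetaFactor X x) n = formalZeta X n :=
  have := northcott_pointNorm f
  tendsTo_eulerProduct_ofPowerSeries (pointNorm X) _ (fun _ => by simp) n

lemma eventually_prod_psiFactor (n : ℕ) :
    ∀ᶠ S : Finset Nat.Primes in atTop, (∏ p ∈ S, psiFactor f p) n = formalPsi f n :=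
  tendsTo_eulerProduct_ofPowerSeries (fun p : Nat.Primes => p.1) _
    (fun p => constantCoeff_psiSeries (primeFibreMap f p)) n

lemma isMultiplicative_formalPsi : (formalPsi f).IsMultiplicative :=
  isMultiplicative_eulerProduct _ fun p => isMultiplicative_ofPowerSeries_of_isPrimePow _
    p.2.isPrimePow _ (constantCoeff_psiSeries (primeFibreMap f p))

lemma primePart_formalPsi (p : Nat.Primes) :
    primePart p (formalPsi f) = psiSeries (primeFibreMap f p) := by
  let _ : TopologicalSpace ℚ := ⊥
  have : DiscreteTopology ℚ := ⟨rfl⟩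
  have hself : primePart p (psiFactor f p) = psiSeries (primeFibreMap f p) :=
    primePart_ofPowerSeries_self p _
  rw [← hself]
  refine (hasProd_primePart (eventually_prod_psiFactor f) p).unique
    (hasProd_single p fun p' hp' => ?_)
  have hne := primePart_ofPowerSeries_of_ne hp' one_ne_zero
    (constantCoeff_psiSeries (primeFibreMap f p'))
  rwa [pow_one] at hne

lemma primePart_formalZeta (p : Nat.Primes) :
    primePart p (formalZeta X) = hasseWeilZeta (primeFibreMap f p) := by
  let _ : TopologicalSpace ℚ := ⊥
  have : DiscreteTopology ℚ := ⟨rfl⟩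
  have h := hasProd_primePart (eventually_prod_zetaFactor f) p
  rw [← hasProd_primeFibre_iff f p] at h
  · refine h.unique ?_
    convert! hasProd_hasseWeilFactor (primeFibreMap f p) using 2 with z
    rw [zetaFactor, pointNorm_sigmaPrimeFibreEquiv,
      primePart_ofPowerSeries_pow p (pointDegree_ne_zero (primeFibreMap f p) z),
      hasseWeilFactor_eq, inv_one_sub_X]
  · intro p' z hp'
    rw [zetaFactor, pointNorm_sigmaPrimeFibreEquiv]
    exact primePart_ofPowerSeries_of_ne hp' (pointDegree_ne_zero (primeFibreMap f p') z) (by simp)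

end FormalDirichlet

section FormalAffineLine

open ArithmeticFunction

variable {X : Scheme.{0}}

variable (X) in
/-- The closed points of `X × 𝔸¹` are the monic irreducible polynomials over the residue fields of
the closed points of `X`. -/
def sigmaMonicIrredEquiv [JacobsonSpace X] :
    (Σ x : closedPoints X, MonicIrred (X.residueField x.1)) ≃ closedPoints (affineLine X) :=
  (Equiv.sigmaCongrRight fun x : closedPoints X => monicIrredEquiv (X.residueField x.1)).trans
    (sigmaAffineLineEquiv X)

lemma pointNorm_sigmaMonicIrredEquiv [JacobsonSpace X] (x : closedPoints X)
    (P : MonicIrred (X.residueField x.1)) :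
    pointNorm (affineLine X) (sigmaMonicIrredEquiv X ⟨x, P⟩) =
      pointNorm X x ^ P.1.natDegree :=
  (pointNorm_sigmaAffineLineEquiv X x _).trans (pointNorm_monicIrredEquiv P)

variable (f : X ⟶ Spec (.of ℤ)) [LocallyOfFiniteType f]

lemma constantCoeff_mk_pow (c : ℚ) : PowerSeries.constantCoeff (.mk fun n => c ^ n) = 1 := by
  rw [← PowerSeries.coeff_zero_eq_constantCoeff_apply, PowerSeries.coeff_mk, pow_zero]

include f in
lemma hasProd_primePart_zetaFactor_fibre [JacobsonSpace X] [TopologicalSpace ℚ]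
    [DiscreteTopology ℚ] (p : Nat.Primes) (x : closedPoints X) :
    HasProd (fun P => primePart p (zetaFactor (affineLine X) (sigmaMonicIrredEquiv X ⟨x, P⟩)))
      (primePart p (ofPowerSeries (pointNorm X x) (.mk fun n => (pointNorm X x : ℚ) ^ n))) := by
  have := finite_residueField_of_int f x
  obtain ⟨p', d, hd, hN⟩ := exists_pointNorm_eq_prime_pow f x
  have hdP (P : MonicIrred (X.residueField x.1)) : d * P.1.natDegree ≠ 0 :=
    mul_ne_zero hd P.natDegree_ne_zero
  simp only [zetaFactor, pointNorm_sigmaMonicIrredEquiv]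
  by_cases hp : p' = p
  · subst hp
    convert! (hasProd_expand_natDegree (K := X.residueField x.1) (R := ℚ)).map
      (PowerSeries.expand d hd) (continuous_expand hd) using 2 with P
    · rw [hN, ← pow_mul, primePart_ofPowerSeries_pow _ (hdP P), inv_one_sub_X]
      exact PowerSeries.expand_mul _ _ _ _ _
    · nth_rw 1 [hN]
      exact primePart_ofPowerSeries_pow _ hd _
  · have htrivial (P : MonicIrred (X.residueField x.1)) :
        primePart p (ofPowerSeries (pointNorm X x ^ P.1.natDegree)
          (1 - PowerSeries.X : PowerSeries ℚ)⁻¹) = 1 := by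
      rw [hN, ← pow_mul]
      exact primePart_ofPowerSeries_of_ne hp (hdP P) (by simp)
    simp_rw [htrivial]
    rw [hN, primePart_ofPowerSeries_of_ne hp hd (constantCoeff_mk_pow _)]
    exact hasProd_one

variable [QuasiCompact f]

lemma primePart_formalZeta_affineLine (p : Nat.Primes) :
    primePart p (formalZeta (affineLine X)) =
      PowerSeries.rescale (p.1 : ℚ) (hasseWeilZeta (primeFibreMap f p)) := by
  let _ : TopologicalSpace ℚ := ⊥
  have : DiscreteTopology ℚ := ⟨rfl⟩
  have : JacobsonSpace X := LocallyOfFiniteType.jacobsonSpace f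
  have : RegularSpace (PowerSeries ℚ) := inferInstanceAs (RegularSpace ((Unit →₀ ℕ) → ℚ))
  have h := hasProd_primePart (eventually_prod_zetaFactor ((affineLine X ↘ X) ≫ f)) p
  rw [← (sigmaMonicIrredEquiv X).hasProd_iff] at h
  have h' := h.sigma (hasProd_primePart_zetaFactor_fibre f p)
  rw [← hasProd_primeFibre_iff f p] at h'
  · refine h'.unique ?_
    convert! (hasProd_hasseWeilFactor (primeFibreMap f p)).map (PowerSeries.rescale (p.1 : ℚ))
      (continuous_rescale _) using 2 with z
    rw [Function.comp_apply, pointNorm_sigmaPrimeFibreEquiv,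
      primePart_ofPowerSeries_pow p (pointDegree_ne_zero (primeFibreMap f p) z),
      hasseWeilFactor_eq, rescale_expand_mk_one, Nat.cast_pow]
  · intro p' z hp'
    rw [pointNorm_sigmaPrimeFibreEquiv]
    exact primePart_ofPowerSeries_of_ne hp' (pointDegree_ne_zero (primeFibreMap f p') z)
      (constantCoeff_mk_pow _)

lemma formalPsi_mul_atTwoS :
    formalPsi f * atTwoS (formalZeta X) = formalZeta X * formalZeta (affineLine X) := by
  have hZ := isMultiplicative_formalZeta f
  have hZA := isMultiplicative_formalZeta ((affineLine X ↘ X) ≫ f)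
  rw [IsMultiplicative.eq_iff_eq_on_prime_powers _
    ((isMultiplicative_formalPsi f).mul (isMultiplicative_atTwoS hZ)) _ (hZ.mul hZA)]
  intro p n hp
  obtain ⟨p, rfl⟩ : ∃ q : Nat.Primes, q.1 = p := ⟨⟨p, hp⟩, rfl⟩
  have h := psiSeries_mul_expand (primeFibreMap f p)
  rw [← primePart_formalPsi f p, Nat.card_zmod, ← primePart_formalZeta_affineLine f p,
    ← primePart_formalZeta f p, ← primePart_atTwoS, ← map_mul, ← map_mul] at h
  simpa only [coeff_primePart] using congrArg (PowerSeries.coeff n) h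

end FormalAffineLine

section EulerProduct

variable {ι : Type*}

/-- Splits off the value at `i` from a finitely supported function with support in `insert i S`. -/
def supportInsertEquiv [DecidableEq ι] {i : ι} {S : Finset ι} (hi : i ∉ S) :
    {α : ι →₀ ℕ // α.support ⊆ insert i S} ≃ ℕ × {α : ι →₀ ℕ // α.support ⊆ S} where
  toFun α := (α.1 i, ⟨α.1.erase i, by
    rw [Finsupp.support_erase]
    exact Finset.subset_insert_iff.mp α.2⟩)
  invFun q := ⟨q.2.1.update i q.1, fun j hj => by
    rw [Finset.mem_insert]
    by_cases h : j = i
    · exact .inl h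
    · rw [Finsupp.mem_support_iff, Finsupp.update_apply, if_neg h] at hj
      exact .inr (q.2.2 (Finsupp.mem_support_iff.mpr hj))⟩
  left_inv α := Subtype.ext (by ext j; by_cases h : j = i <;> simp [h])
  right_inv q := Prod.ext (by simp) <| Subtype.ext <|
    (Finsupp.erase_update_eq_erase _ _ _).trans <|
      Finsupp.erase_of_notMem_support fun h => hi (q.2.2 h)

variable {𝕜 : Type*} [NormedField 𝕜] {g : ι → ℕ → 𝕜}

lemma prod_supportInsertEquiv_symm [DecidableEq ι] (hg : ∀ i, g i 0 = 1) {i : ι} {S : Finset ι}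
    (hi : i ∉ S) (q : ℕ × {α : ι →₀ ℕ // α.support ⊆ S}) :
    ((supportInsertEquiv hi).symm q).1.prod g = g i q.1 * q.2.1.prod g := by
  obtain ⟨α, rfl⟩ := (supportInsertEquiv hi).surjective q
  rw [Equiv.symm_apply_apply]
  exact (Finsupp.mul_prod_erase' α.1 i g hg).symm

instance : Unique {α : ι →₀ ℕ // α.support ⊆ ∅} where
  default := ⟨0, Finsupp.support_zero.subset⟩
  uniq α := Subtype.ext (Finsupp.support_eq_empty.mp (Finset.subset_empty.mp α.2))

lemma summable_norm_prod_of_support_subset (hg : ∀ i, g i 0 = 1)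
    (hs : ∀ i, Summable fun a => ‖g i a‖) (S : Finset ι) :
    Summable fun α : {α : ι →₀ ℕ // α.support ⊆ S} => ‖α.1.prod g‖ := by
  classical
  induction S using Finset.induction_on with
  | empty => exact (hasSum_fintype _).summable
  | insert i S hi ih =>
    rw [← (supportInsertEquiv hi).symm.summable_iff]
    simp only [Function.comp_def, prod_supportInsertEquiv_symm hg hi]
    exact (hs i).mul_norm (g := fun α : {α : ι →₀ ℕ // α.support ⊆ S} => α.1.prod g) ih

lemma tsum_prod_of_support_subset [CompleteSpace 𝕜] (hg : ∀ i, g i 0 = 1)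
    (hs : ∀ i, Summable fun a => ‖g i a‖) (S : Finset ι) :
    ∑' α : {α : ι →₀ ℕ // α.support ⊆ S}, α.1.prod g = ∏ i ∈ S, ∑' a, g i a := by
  classical
  induction S using Finset.induction_on with
  | empty => exact (tsum_fintype _).trans (Fintype.sum_unique _)
  | insert i S hi ih =>
    rw [← (supportInsertEquiv hi).symm.tsum_eq]
    simp only [prod_supportInsertEquiv_symm hg hi]
    rw [Finset.prod_insert hi, ← ih, tsum_mul_tsum_of_summable_norm
      (g := fun α : {α : ι →₀ ℕ // α.support ⊆ S} => α.1.prod g) (hs i)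
      (summable_norm_prod_of_support_subset hg hs S)]

lemma sum_prod_le_prod_tsum {v : ι → ℕ → ℝ} (hv : ∀ i a, 0 ≤ v i a) (hv0 : ∀ i, v i 0 = 1)
    (hs : ∀ i, Summable (v i)) (F : Finset (ι →₀ ℕ)) {S : Finset ι}
    (hF : ∀ α ∈ F, α.support ⊆ S) : ∑ α ∈ F, α.prod v ≤ ∏ i ∈ S, ∑' a, v i a := by
  classical
  have hs' : ∀ i, Summable fun a => ‖v i a‖ := fun i => (hs i).norm
  rw [← tsum_prod_of_support_subset hv0 hs' S, ← Finset.sum_subtype_of_mem _ hF]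
  exact (summable_norm_prod_of_support_subset hv0 hs' S).of_norm.sum_le_tsum _ fun _ _ =>
    Finset.prod_nonneg fun _ _ => hv _ _

lemma summable_norm_of_summable_succ (hs : Summable fun q : ι × ℕ => ‖g q.1 (q.2 + 1)‖) (i : ι) :
    Summable fun a => ‖g i a‖ :=
  (summable_nat_add_iff 1).mp (hs.prod_factor i)

lemma summable_norm_finsuppProd (hg : ∀ i, g i 0 = 1)
    (hs : Summable fun q : ι × ℕ => ‖g q.1 (q.2 + 1)‖) :
    Summable fun α : ι →₀ ℕ => ‖α.prod g‖ := by
  classical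
  have hs' := summable_norm_of_summable_succ hs
  refine summable_of_sum_le (c := Real.exp (∑' i, ∑' a, ‖g i (a + 1)‖)) (fun _ => norm_nonneg _)
    fun F => ?_
  let S : Finset ι := F.biUnion Finsupp.support
  calc ∑ α ∈ F, ‖α.prod g‖ = ∑ α ∈ F, α.prod fun i a => ‖g i a‖ := by
        simp only [Finsupp.prod, norm_prod]
    _ ≤ ∏ i ∈ S, ∑' a, ‖g i a‖ :=
        sum_prod_le_prod_tsum (fun _ _ => norm_nonneg _) (fun i => by rw [hg, norm_one]) hs' F
          fun α hα => Finset.subset_biUnion_of_mem Finsupp.support hα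
    _ = ∏ i ∈ S, (1 + ∑' a, ‖g i (a + 1)‖) := by
        refine Finset.prod_congr rfl fun i _ => ?_
        rw [(hs' i).tsum_eq_zero_add, hg, norm_one]
    _ ≤ Real.exp (∑ i ∈ S, ∑' a, ‖g i (a + 1)‖) :=
        Real.prod_one_add_le_exp_sum S fun _ => tsum_nonneg fun _ => norm_nonneg _
    _ ≤ Real.exp (∑' i, ∑' a, ‖g i (a + 1)‖) :=
        Real.exp_le_exp.mpr (hs.prod.sum_le_tsum S fun _ _ => tsum_nonneg fun _ => norm_nonneg _)

variable [CompleteSpace 𝕜]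

lemma hasProd_tsum_finsuppProd (hg : ∀ i, g i 0 = 1)
    (hs : Summable fun q : ι × ℕ => ‖g q.1 (q.2 + 1)‖) :
    HasProd (fun i => ∑' a, g i a) (∑' α : ι →₀ ℕ, α.prod g) := by
  have hpartial : ∀ S : Finset ι, ∏ i ∈ S, ∑' a, g i a =
      ∑' α : ι →₀ ℕ, Set.indicator {α : ι →₀ ℕ | α.support ⊆ S} (fun α => α.prod g) α := by
    intro S
    rw [← tsum_prod_of_support_subset hg (summable_norm_of_summable_succ hs) S]
    exact tsum_subtype {α : ι →₀ ℕ | α.support ⊆ S} fun α => α.prod g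
  rw [HasProd, SummationFilter.unconditional_filter]
  simp_rw [hpartial]
  refine tendsto_tsum_of_dominated_convergence (summable_norm_finsuppProd hg hs) (fun α => ?_)
    (.of_forall fun S α => norm_indicator_le_norm_self _ _)
  refine tendsto_const_nhds.congr' ?_
  filter_upwards [eventually_ge_atTop α.support] with S hS
  have hmem : α ∈ {α : ι →₀ ℕ | α.support ⊆ S} := hS
  exact (Set.indicator_of_mem hmem fun α : ι →₀ ℕ => α.prod g).symm

lemma summable_pow_succ {v : ι → ℝ} (hv0 : ∀ i, 0 ≤ v i) (hv : Summable v) (hv1 : ∀ i, v i < 1) :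
    Summable fun q : ι × ℕ => v q.1 ^ (q.2 + 1) := by
  have hgeo : ∀ i, Summable fun a => v i ^ (a + 1) := fun i =>
    (summable_nat_add_iff 1).mpr (summable_geometric_of_lt_one (hv0 i) (hv1 i))
  rw [summable_prod_of_nonneg fun q => pow_nonneg (hv0 q.1) _]
  refine ⟨hgeo, .of_norm_bounded_eventually (hv.mul_right 2) ?_⟩
  have hhalf : ∀ᶠ i in cofinite, v i < 1 / 2 :=
    hv.tendsto_cofinite_zero.eventually_lt_const (by norm_num)
  filter_upwards [hhalf] with i hi
  have h2 : (1 - v i)⁻¹ ≤ 2 := inv_le_of_inv_le₀ two_pos (by linarith)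
  simp only [pow_succ', tsum_mul_left, tsum_geometric_of_lt_one (hv0 i) (hv1 i)]
  rw [Real.norm_of_nonneg (mul_nonneg (hv0 i) (inv_nonneg.mpr (sub_nonneg.mpr (hv1 i).le)))]
  gcongr
  exact hv0 i

lemma hasProd_inv_one_sub {w : ι → 𝕜} (hw : Summable fun i => ‖w i‖) (hw1 : ∀ i, ‖w i‖ < 1) :
    HasProd (fun i => (1 - w i)⁻¹) (∑' α : ι →₀ ℕ, α.prod fun i a => w i ^ a) := by
  have h := hasProd_tsum_finsuppProd (g := fun i a => w i ^ a) (fun i => pow_zero _) <| by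
    simpa only [norm_pow] using summable_pow_succ (fun _ => norm_nonneg _) hw hw1
  simpa only [tsum_geometric_of_norm_lt_one (hw1 _)] using h

omit [CompleteSpace 𝕜] in
lemma one_sub_ne_zero_of_norm_lt_one {w : 𝕜} (hw : ‖w‖ < 1) : 1 - w ≠ 0 := fun h => by
  rw [← sub_eq_zero.mp h, norm_one] at hw
  exact lt_irrefl _ hw

lemma tprod_inv_one_sub_ne_zero {w : ι → 𝕜} (hw : Summable fun i => ‖w i‖)
    (hw1 : ∀ i, ‖w i‖ < 1) : ∏' i, (1 - w i)⁻¹ ≠ 0 := by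
  have hne i : 1 - w i ≠ 0 := one_sub_ne_zero_of_norm_lt_one (hw1 i)
  have hmul : Multipliable fun i => 1 - w i := by
    simpa only [sub_eq_add_neg] using
      multipliable_one_add_of_summable (f := fun i => -w i) (by simpa only [norm_neg] using hw)
  have h := hmul.hasProd.mul (hasProd_inv_one_sub hw hw1).multipliable.hasProd
  simp only [mul_inv_cancel₀ (hne _)] at h
  exact right_ne_zero_of_mul_eq_one (h.unique hasProd_one)

end EulerProduct

lemma prod_pow_pow_eq_pow_weight {ι M : Type*} [CommMonoid M] (d : ι → ℕ) (u : M) (α : ι →₀ ℕ) :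
    (α.prod fun i a => (u ^ d i) ^ a) = u ^ Finsupp.weight d α := by
  rw [Finsupp.weight_apply, Finsupp.sum, ← Finset.prod_pow_eq_pow_sum]
  refine Finset.prod_congr rfl fun i _ => ?_
  rw [smul_eq_mul, mul_comm, pow_mul]

section Fibres

variable {ι 𝕜 : Type*} [NormedField 𝕜] {N : ι → ℕ}

lemma tsum_fibre (F : ℕ → 𝕜) (n : ℕ) :
    ∑' i : {i // N i = n}, F (N i) = Nat.card {i // N i = n} * F n := by
  rw [tsum_congr fun i => congrArg F i.2, tsum_const, nsmul_eq_mul]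

lemma summable_comp_iff_of_finite_fibres (hN : ∀ n, {i | N i = n}.Finite) {F : ℕ → ℝ}
    (hF : ∀ n, 0 ≤ F n) :
    (Summable fun i => F (N i)) ↔ Summable fun n => Nat.card {i // N i = n} * F n := by
  have (n : ℕ) : Finite {i // N i = n} := hN n
  rw [← (Equiv.sigmaFiberEquiv N).summable_iff, Function.comp_def,
    summable_sigma_of_nonneg fun _ => hF _]
  simp only [Summable.of_finite, implies_true, true_and,
    Equiv.sigmaFiberEquiv_apply, tsum_fibre]

lemma tsum_comp_eq [CompleteSpace 𝕜] {F : ℕ → 𝕜} (hF : Summable fun i => F (N i)) :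
    ∑' i, F (N i) = ∑' n, Nat.card {i // N i = n} * F n := by
  rw [← (Equiv.sigmaFiberEquiv N).tsum_eq]
  refine ((Equiv.sigmaFiberEquiv N).summable_iff.mpr hF).tsum_sigma.trans ?_
  exact tsum_congr fun n => tsum_fibre F n

lemma summable_rpow_of_encard_le (hN : ∀ i, N i ≠ 0) {C r : ℕ}
    (h : ∀ n ≠ 0, {i | N i = n}.encard ≤ (C * n ^ r : ℕ)) {σ : ℝ} (hσ : r + 1 < σ) :
    Summable fun i => (N i : ℝ) ^ (-σ) := by
  have hfin (n : ℕ) : {i | N i = n}.Finite := by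
    rcases eq_or_ne n 0 with rfl | hn
    · simp [hN]
    · exact Set.finite_of_encard_le_coe (h n hn)
  have hcard (n : ℕ) (hn : n ≠ 0) : (Nat.card {i // N i = n} : ℝ) ≤ C * (n : ℝ) ^ r := by
    have := h n hn
    rw [← (hfin n).cast_ncard_eq, ENat.natCast_le_natCast] at this
    exact_mod_cast this
  rw [summable_comp_iff_of_finite_fibres (F := fun n => (n : ℝ) ^ (-σ)) hfin
    fun _ => by positivity]
  have hsum : Summable fun n : ℕ => (C : ℝ) * (n : ℝ) ^ (r - σ) :=
    (Real.summable_nat_rpow.mpr (by linarith)).mul_left _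
  refine hsum.of_nonneg_of_le (fun _ => by positivity) fun n => ?_
  rcases eq_or_ne n 0 with rfl | hn
  · have : IsEmpty {i // N i = 0} := ⟨fun i => hN i i.2⟩
    rw [Nat.card_of_isEmpty, Nat.cast_zero, zero_mul]
    positivity
  · rw [sub_eq_add_neg, Real.rpow_add (Nat.cast_pos.mpr (Nat.pos_of_ne_zero hn)),
      Real.rpow_natCast, ← mul_assoc]
    gcongr
    exact hcard n hn

end Fibres

section AffineLineOverFiniteField

variable {K : Type*} [Field K] [Finite K] {𝕜 : Type*} [NormedField 𝕜]

lemma summable_pow_weight_natDegree_iff {r : ℝ} (hr : 0 ≤ r) :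
    (Summable fun α : MonicIrred K →₀ ℕ => r ^ Finsupp.weight (·.1.natDegree) α) ↔
      Nat.card K * r < 1 := by
  rw [summable_comp_iff_of_finite_fibres (F := fun n => r ^ n)
    (finite_setOf_weight_eq MonicIrred.natDegree_ne_zero) fun n => pow_nonneg hr n]
  simp only [natCard_setOf_weight_natDegree_eq, Nat.cast_pow, ← mul_pow]
  rw [summable_geometric_iff_norm_lt_one, Real.norm_of_nonneg (by positivity)]

variable [CompleteSpace 𝕜] {u : 𝕜} (hu : Nat.card K * ‖u‖ < 1)

include hu

lemma tsum_pow_weight_natDegree :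
    ∑' α : MonicIrred K →₀ ℕ, u ^ Finsupp.weight (·.1.natDegree) α =
      (1 - Nat.card K * u)⁻¹ := by
  have hsum : Summable fun α : MonicIrred K →₀ ℕ =>
      u ^ Finsupp.weight (·.1.natDegree) α := .of_norm <| by
    simpa only [norm_pow] using (summable_pow_weight_natDegree_iff (norm_nonneg u)).mpr hu
  have hnorm : ‖Nat.card K * u‖ < 1 := (norm_mul_le _ _).trans_lt <|
    (mul_le_mul_of_nonneg_right (by simpa using Nat.norm_cast_le (α := 𝕜) (Nat.card K))
      (norm_nonneg u)).trans_lt hu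
  rw [tsum_comp_eq (F := fun n => u ^ n) hsum, ← tsum_geometric_of_norm_lt_one hnorm]
  simp only [natCard_setOf_weight_natDegree_eq, Nat.cast_pow, ← mul_pow]

lemma hasProd_inv_one_sub_pow_natDegree :
    HasProd (fun P : MonicIrred K => (1 - u ^ P.1.natDegree)⁻¹) (1 - Nat.card K * u)⁻¹ := by
  have hu1 : ‖u‖ < 1 := (le_mul_of_one_le_left (norm_nonneg u)
    (Nat.one_le_cast.mpr Nat.card_pos)).trans_lt hu
  have hP : Summable fun P : MonicIrred K => ‖u ^ P.1.natDegree‖ := by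
    simpa [Function.comp_def, Finsupp.weight_single] using
      ((summable_pow_weight_natDegree_iff (norm_nonneg u)).mpr hu).comp_injective
        (Finsupp.single_left_injective one_ne_zero)
  rw [← tsum_pow_weight_natDegree hu]
  simp only [← prod_pow_pow_eq_pow_weight]
  refine hasProd_inv_one_sub hP fun P => ?_
  rw [norm_pow]
  exact pow_lt_one₀ (norm_nonneg u) hu1 P.natDegree_ne_zero

omit hu [CompleteSpace 𝕜] in
lemma one_lt_of_summable_natDegree {σ : ℝ}
    (h : Summable fun P : MonicIrred K => ((Nat.card K ^ P.1.natDegree : ℕ) : ℝ) ^ (-σ)) :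
    1 < σ := by
  by_contra! hσ
  have hQ : (1 : ℝ) < Nat.card K := Nat.one_lt_cast.mpr Finite.one_lt_card
  have hQ1 : (Nat.card K : ℝ)⁻¹ < 1 := inv_lt_one_of_one_lt₀ hQ
  have hP : Summable fun P : MonicIrred K => (Nat.card K : ℝ)⁻¹ ^ P.1.natDegree := by
    refine h.of_nonneg_of_le (fun _ => by positivity) fun P => ?_
    rw [inv_pow, Nat.cast_pow, ← Real.rpow_neg_one]
    exact Real.rpow_le_rpow_of_exponent_le (one_le_pow₀ hQ.le) (by linarith)
  have hα := summable_norm_finsuppProd (g := fun (P : MonicIrred K) a =>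
    ((Nat.card K : ℝ)⁻¹ ^ P.1.natDegree) ^ a) (fun _ => pow_zero _) <| by
      simpa using summable_pow_succ (fun _ => by positivity) hP fun P : MonicIrred K =>
        pow_lt_one₀ (by positivity) hQ1 P.natDegree_ne_zero
  simp only [prod_pow_pow_eq_pow_weight] at hα
  have hlt := (summable_pow_weight_natDegree_iff (by positivity)).mp hα.of_norm
  rw [mul_inv_cancel₀ (by positivity)] at hlt
  exact lt_irrefl _ hlt

end AffineLineOverFiniteField

lemma natCast_pow_cpow (n d : ℕ) (s : ℂ) : ((n ^ d : ℕ) : ℂ) ^ s = ((n : ℂ) ^ s) ^ d := by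
  rw [Nat.cast_pow, ← Complex.natCast_cpow_natCast_mul, Complex.cpow_nat_mul]

/-- The linear polynomial `X - a` as a monic irreducible polynomial, i.e. the rational point `a` of
the affine line. -/
def linearMonicIrred {K : Type*} [Field K] (a : K) : MonicIrred K :=
  ⟨Polynomial.X - Polynomial.C a, Polynomial.monic_X_sub_C a, Polynomial.irreducible_X_sub_C a⟩

lemma linearMonicIrred_injective {K : Type*} [Field K] :
    Function.Injective (linearMonicIrred (K := K)) :=
  fun _ _ h => Polynomial.C_injective (sub_right_injective (congrArg Subtype.val h))

lemma natDegree_linearMonicIrred {K : Type*} [Field K] (a : K) :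
    (linearMonicIrred a).1.natDegree = 1 :=
  Polynomial.natDegree_X_sub_C a

section Convergence

variable {X : Scheme.{0}} (f : X ⟶ Spec (.of ℤ)) [LocallyOfFiniteType f]

include f

lemma exists_summable_pointNorm_rpow [QuasiCompact f] :
    ∃ σ : ℝ, ∀ r : ℝ, σ < r → Summable fun x : closedPoints X => (pointNorm X x : ℝ) ^ (-r) := by
  obtain ⟨C, r, h⟩ := exists_encard_pointNorm_eq_le f
  exact ⟨r + 1, fun _ => summable_rpow_of_encard_le
    (fun x => (zero_lt_one.trans (one_lt_pointNorm f x)).ne') h⟩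

variable {σ : ℝ} (h : Summable fun y : closedPoints (affineLine X) =>
  (pointNorm (affineLine X) y : ℝ) ^ (-σ))

include h

omit f [LocallyOfFiniteType f] in
lemma summable_sigma_monicIrred [JacobsonSpace X] :
    Summable fun q : Σ x : closedPoints X, MonicIrred (X.residueField x.1) =>
      ((pointNorm X q.1 ^ q.2.1.natDegree : ℕ) : ℝ) ^ (-σ) := by
  refine ((sigmaMonicIrredEquiv X).summable_iff.mpr h).congr fun q => ?_
  rw [Function.comp_apply, pointNorm_sigmaMonicIrredEquiv]

lemma summable_pointNorm_rpow_one_sub :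
    Summable fun x : closedPoints X => (pointNorm X x : ℝ) ^ (1 - σ) := by
  have : JacobsonSpace X := LocallyOfFiniteType.jacobsonSpace f
  have hinj : Function.Injective fun q : Σ x : closedPoints X, X.residueField x.1 =>
      (⟨q.1, linearMonicIrred q.2⟩ : Σ x : closedPoints X, MonicIrred (X.residueField x.1)) :=
    Function.injective_id.sigma_map
      (β₂ := fun x : closedPoints X => MonicIrred (X.residueField x.1))
      (f₂ := fun _ => linearMonicIrred) fun _ => linearMonicIrred_injective
  refine ((summable_sigma_monicIrred h).comp_injective hinj).sigma.congr fun x => ?_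
  simp only [Function.comp_apply, natDegree_linearMonicIrred, pow_one]
  rw [tsum_const, nsmul_eq_mul, sub_eq_add_neg,
    Real.rpow_add (Nat.cast_pos.mpr (zero_lt_one.trans (one_lt_pointNorm f x))), Real.rpow_one]
  rfl

lemma one_lt_of_summable_affineLine (x : closedPoints X) : 1 < σ := by
  have : JacobsonSpace X := LocallyOfFiniteType.jacobsonSpace f
  have := finite_residueField_of_int f x
  exact one_lt_of_summable_natDegree ((summable_sigma_monicIrred h).sigma_factor x)

lemma pointNorm_rpow_one_sub_lt_one (x : closedPoints X) :
    (pointNorm X x : ℝ) ^ (1 - σ) < 1 :=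
  Real.rpow_lt_one_of_one_lt_of_neg (Nat.one_lt_cast.mpr (one_lt_pointNorm f x))
    (by linarith [one_lt_of_summable_affineLine f h x])

lemma pos_of_summable_affineLine (y : closedPoints (affineLine X)) : 0 < σ := by
  have : JacobsonSpace X := LocallyOfFiniteType.jacobsonSpace f
  exact zero_lt_one.trans
    (one_lt_of_summable_affineLine f h ((sigmaMonicIrredEquiv X).symm y).1)

lemma summable_affineLine_two_mul :
    Summable fun y : closedPoints (affineLine X) =>
      (pointNorm (affineLine X) y : ℝ) ^ (-(2 * σ)) := by
  refine h.of_nonneg_of_le (fun _ => by positivity) fun y => ?_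
  refine Real.rpow_le_rpow_of_exponent_le (Nat.one_le_cast.mpr
    (one_lt_pointNorm ((affineLine X ↘ X) ≫ f) y).le) ?_
  linarith [pos_of_summable_affineLine f h y]

end Convergence

section LocalFactor

variable {𝕜 : Type*} [NormedField 𝕜]

lemma one_add_mul_inv_one_sub_sq {w : 𝕜} (hw : ‖w‖ < 1) :
    (1 + w) * (1 - w ^ 2)⁻¹ = (1 - w)⁻¹ := by
  have hsub : 1 - w ≠ 0 := one_sub_ne_zero_of_norm_lt_one hw
  have hadd : 1 + w ≠ 0 := by
    simpa only [sub_neg_eq_add] using one_sub_ne_zero_of_norm_lt_one ((norm_neg w).trans_lt hw)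
  rw [show 1 - w ^ 2 = (1 - w) * (1 + w) by ring]
  field_simp

lemma psiCoeff_succ_mul_pow (N w : 𝕜) (a : ℕ) :
    psiCoeff N (a + 1) * w ^ (a + 1) = (1 + N⁻¹) * (N * w) ^ (a + 1) := by
  rw [psiCoeff, if_neg a.succ_ne_zero]
  ring

lemma tsum_psiCoeff_mul_pow [CompleteSpace 𝕜] {N w : 𝕜} (hN : N ≠ 0) (hw : ‖N * w‖ < 1) :
    ∑' a, psiCoeff N a * w ^ a = (1 + w) * (1 - N * w)⁻¹ := by
  have hne : 1 - N * w ≠ 0 := one_sub_ne_zero_of_norm_lt_one hw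
  have hsucc (a : ℕ) : psiCoeff N (a + 1) * w ^ (a + 1) = (N * w + w) * (N * w) ^ a := by
    rw [psiCoeff_succ_mul_pow]
    field_simp
    ring
  have hsum : Summable fun a => psiCoeff N a * w ^ a := by
    rw [← summable_nat_add_iff 1]
    simp only [hsucc]
    exact (summable_geometric_of_norm_lt_one hw).mul_left _
  rw [hsum.tsum_eq_zero_add, psiCoeff_zero]
  simp only [hsucc]
  rw [tsum_mul_left, tsum_geometric_of_norm_lt_one hw]
  field_simp
  ring

lemma summable_norm_psiCoeff_mul_pow_succ {ι : Type*} {N w : ι → 𝕜} (hN : ∀ i, 1 ≤ ‖N i‖)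
    (hs : Summable fun i => ‖N i * w i‖) (hlt : ∀ i, ‖N i * w i‖ < 1) :
    Summable fun q : ι × ℕ => ‖psiCoeff (N q.1) (q.2 + 1) * w q.1 ^ (q.2 + 1)‖ := by
  refine ((summable_pow_succ (fun _ => norm_nonneg _) hs hlt).mul_left 2).of_nonneg_of_le
    (fun _ => norm_nonneg _) fun ⟨i, a⟩ => ?_
  have htwo : ‖1 + (N i)⁻¹‖ ≤ 2 := by
    refine (norm_add_le _ _).trans ?_
    rw [norm_one, norm_inv]
    linarith [inv_le_one_of_one_le₀ (hN i)]
  rw [psiCoeff_succ_mul_pow, norm_mul, norm_pow]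
  gcongr

end LocalFactor

section AnalyticIdentity

/-- The term `ψ(a x) N(x) ^ (-a s)` of the Euler factor of `Ψ_X(s)` at the closed point `x`. -/
def psiTerm (X : Scheme.{0}) (s : ℂ) (x : closedPoints X) (a : ℕ) : ℂ :=
  psiCoeff (pointNorm X x : ℂ) a * ((pointNorm X x : ℂ) ^ (-s)) ^ a

lemma psiTerm_zero (X : Scheme.{0}) (s : ℂ) (x : closedPoints X) : psiTerm X s x 0 = 1 := by
  rw [psiTerm, psiCoeff_zero, pow_zero, mul_one]

variable {X : Scheme.{0}} (f : X ⟶ Spec (.of ℤ)) [LocallyOfFiniteType f]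

lemma psi_mul_pow (p : Nat.Primes) (α : EffZeroCycle (primeFibre f p)) (s : ℂ) :
    (psi (primeFibreMap f p) α : ℂ) * ((p : ℂ) ^ (-s)) ^ cycleDegree (primeFibreMap f p) α =
      α.prod fun z => psiTerm X s (sigmaPrimeFibreEquiv f ⟨p, z⟩) := by
  rw [psi_eq_prod_psiCoeff, cycleDegree, Finsupp.sum, ← Finset.prod_pow_eq_pow_sum, Nat.card_zmod,
    Finsupp.prod, Rat.cast_prod, ← Finset.prod_mul_distrib]
  refine Finset.prod_congr rfl fun z _ => ?_
  beta_reduce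
  rw [psiTerm, pointNorm_sigmaPrimeFibreEquiv, natCast_pow_cpow, mul_comm (α z), pow_mul]
  simp only [psiCoeff, Nat.cast_pow]
  push_cast [apply_ite]
  rfl

variable {s : ℂ}

include f in
lemma norm_pointNorm_cpow_neg (x : closedPoints X) :
    ‖(pointNorm X x : ℂ) ^ (-s)‖ = (pointNorm X x : ℝ) ^ (-s.re) := by
  rw [Complex.norm_natCast_cpow_of_pos (zero_lt_one.trans (one_lt_pointNorm f x)), Complex.neg_re]

include f in
lemma norm_pointNorm_mul_cpow_neg (x : closedPoints X) :
    ‖(pointNorm X x : ℂ) * (pointNorm X x : ℂ) ^ (-s)‖ = (pointNorm X x : ℝ) ^ (1 - s.re) := by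
  rw [norm_mul, norm_pointNorm_cpow_neg f, Complex.norm_natCast, sub_eq_add_neg, Real.rpow_add
    (Nat.cast_pos.mpr (zero_lt_one.trans (one_lt_pointNorm f x))), Real.rpow_one]

include f in
lemma norm_pointNorm_cpow_neg_le (x : closedPoints X) :
    ‖(pointNorm X x : ℂ) ^ (-s)‖ ≤ (pointNorm X x : ℝ) ^ (1 - s.re) := by
  rw [norm_pointNorm_cpow_neg f]
  exact Real.rpow_le_rpow_of_exponent_le (Nat.one_le_cast.mpr (one_lt_pointNorm f x).le)
    (by linarith)

variable (h : Summable fun y : closedPoints (affineLine X) =>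
  (pointNorm (affineLine X) y : ℝ) ^ (-s.re))

include f h

lemma norm_pointNorm_cpow_neg_lt_one (x : closedPoints X) :
    ‖(pointNorm X x : ℂ) ^ (-s)‖ < 1 :=
  (norm_pointNorm_cpow_neg_le f x).trans_lt (pointNorm_rpow_one_sub_lt_one f h x)

lemma norm_pointNorm_mul_cpow_neg_lt_one (x : closedPoints X) :
    ‖(pointNorm X x : ℂ) * (pointNorm X x : ℂ) ^ (-s)‖ < 1 :=
  (norm_pointNorm_mul_cpow_neg f x).trans_lt (pointNorm_rpow_one_sub_lt_one f h x)

lemma summable_norm_pointNorm_cpow_neg :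
    Summable fun x : closedPoints X => ‖(pointNorm X x : ℂ) ^ (-s)‖ :=
  (summable_pointNorm_rpow_one_sub f h).of_nonneg_of_le (fun _ => norm_nonneg _) fun x =>
    norm_pointNorm_cpow_neg_le f x

lemma summable_norm_psiTerm_succ :
    Summable fun q : closedPoints X × ℕ => ‖psiTerm X s q.1 (q.2 + 1)‖ := by
  refine summable_norm_psiCoeff_mul_pow_succ (N := fun x => (pointNorm X x : ℂ))
    (w := fun x => (pointNorm X x : ℂ) ^ (-s)) (fun x => ?_) ?_ fun x =>
      norm_pointNorm_mul_cpow_neg_lt_one f h x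
  · rw [Complex.norm_natCast]
    exact Nat.one_le_cast.mpr (one_lt_pointNorm f x).le
  · exact (summable_pointNorm_rpow_one_sub f h).congr fun x =>
      (norm_pointNorm_mul_cpow_neg f x).symm

lemma tsum_psiTerm (x : closedPoints X) :
    ∑' a, psiTerm X s x a = (1 + (pointNorm X x : ℂ) ^ (-s)) *
      (1 - (pointNorm X x : ℂ) * (pointNorm X x : ℂ) ^ (-s))⁻¹ :=
  tsum_psiCoeff_mul_pow (Nat.cast_ne_zero.mpr (zero_lt_one.trans (one_lt_pointNorm f x)).ne')
    (norm_pointNorm_mul_cpow_neg_lt_one f h x)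

lemma summable_norm_psiTerm_primeFibre (p : Nat.Primes) :
    Summable fun q : closedPoints (primeFibre f p) × ℕ =>
      ‖psiTerm X s (sigmaPrimeFibreEquiv f ⟨p, q.1⟩) (q.2 + 1)‖ := by
  have hinj : Function.Injective fun z => sigmaPrimeFibreEquiv f ⟨p, z⟩ :=
    (sigmaPrimeFibreEquiv f).injective.comp sigma_mk_injective
  exact ((summable_norm_psiTerm_succ f h).comp_injective (hinj.prodMap Function.injective_id)).congr
    fun q => by rw [Function.comp_apply, Prod.map_fst, Prod.map_snd, id]

lemma summable_psi_mul_pow (p : Nat.Primes) :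
    Summable fun α : EffZeroCycle (primeFibre f p) => (psi (primeFibreMap f p) α : ℂ) *
      ((p : ℂ) ^ (-s)) ^ cycleDegree (primeFibreMap f p) α := by
  simp only [psi_mul_pow]
  exact .of_norm <| summable_norm_finsuppProd (fun _ => psiTerm_zero X s _)
    (summable_norm_psiTerm_primeFibre f h p)

lemma hasProd_psiValue (p : Nat.Primes) :
    HasProd (fun z => ∑' a, psiTerm X s (sigmaPrimeFibreEquiv f ⟨p, z⟩) a)
      (psiValue (primeFibreMap f p) ((p : ℂ) ^ (-s))) := by
  simp only [psiValue, psi_mul_pow]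
  exact hasProd_tsum_finsuppProd (fun _ => psiTerm_zero X s _)
    (summable_norm_psiTerm_primeFibre f h p)

lemma multipliable_tsum_psiTerm : Multipliable fun x : closedPoints X => ∑' a, psiTerm X s x a :=
  (hasProd_tsum_finsuppProd (psiTerm_zero X s) (summable_norm_psiTerm_succ f h)).multipliable

lemma hasProd_globalPsi :
    HasProd (fun p => psiValue (primeFibreMap f p) ((p : ℂ) ^ (-s)))
      (∏' x : closedPoints X, ∑' a, psiTerm X s x a) :=
  ((sigmaPrimeFibreEquiv f).hasProd_iff.mpr (multipliable_tsum_psiTerm f h).hasProd).sigma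
    (hasProd_psiValue f h)

lemma multipliable_zeta :
    Multipliable fun x : closedPoints X => (1 - (pointNorm X x : ℂ) ^ (-s))⁻¹ :=
  (hasProd_inv_one_sub (summable_norm_pointNorm_cpow_neg f h)
    (norm_pointNorm_cpow_neg_lt_one f h)).multipliable

lemma zeta_ne_zero : zeta X s ≠ 0 :=
  tprod_inv_one_sub_ne_zero (summable_norm_pointNorm_cpow_neg f h)
    (norm_pointNorm_cpow_neg_lt_one f h)

lemma multipliable_zeta_affineLine :
    Multipliable fun y : closedPoints (affineLine X) =>
      (1 - (pointNorm (affineLine X) y : ℂ) ^ (-s))⁻¹ := by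
  have hnorm := norm_pointNorm_cpow_neg (s := s) ((affineLine X ↘ X) ≫ f)
  refine (hasProd_inv_one_sub ?_ fun y => ?_).multipliable
  · simpa only [hnorm] using h
  · rw [hnorm]
    exact Real.rpow_lt_one_of_one_lt_of_neg
      (Nat.one_lt_cast.mpr (one_lt_pointNorm ((affineLine X ↘ X) ≫ f) y))
      (neg_lt_zero.mpr (pos_of_summable_affineLine f h y))

lemma hasProd_zeta_affineLine :
    HasProd (fun x : closedPoints X =>
      (1 - (pointNorm X x : ℂ) * (pointNorm X x : ℂ) ^ (-s))⁻¹) (zeta (affineLine X) s) := by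
  have : JacobsonSpace X := LocallyOfFiniteType.jacobsonSpace f
  refine ((sigmaMonicIrredEquiv X).hasProd_iff.mpr
    (multipliable_zeta_affineLine f h).hasProd).sigma fun x => ?_
  have := finite_residueField_of_int f x
  simp only [Function.comp_apply, pointNorm_sigmaMonicIrredEquiv, natCast_pow_cpow]
  refine hasProd_inv_one_sub_pow_natDegree ?_
  have hlt := norm_pointNorm_mul_cpow_neg_lt_one f h x
  rwa [norm_mul, Complex.norm_natCast] at hlt

lemma summable_affineLine_re_two_mul :
    Summable fun y : closedPoints (affineLine X) =>
      (pointNorm (affineLine X) y : ℝ) ^ (-(2 * s).re) := by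
  simpa using summable_affineLine_two_mul f h

lemma globalPsi_mul_zeta :
    globalPsi f s * zeta X (2 * s) = zeta X s * zeta (affineLine X) s := by
  have hZ₂ := (multipliable_zeta f (summable_affineLine_re_two_mul f h)).hasProd
  rw [globalPsi, (hasProd_globalPsi f h).tprod_eq]
  refine ((multipliable_tsum_psiTerm f h).hasProd.mul hZ₂).unique ?_
  convert! (multipliable_zeta f h).hasProd.mul (hasProd_zeta_affineLine f h) using 2 with x
  rw [tsum_psiTerm f h, ← mul_neg, Complex.cpow_ofNat_mul, mul_right_comm,
    one_add_mul_inv_one_sub_sq (norm_pointNorm_cpow_neg_lt_one f h x)]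

end AnalyticIdentity

end ArithPsi

end

theorem mainTheorem12 :
    -- The statement over a finite field, as an identity of formal power series.
    (∀ (k : Type) [Field k] [Finite k] (X : Scheme.{0}) (f : X ⟶ Spec (.of k))
      [LocallyOfFiniteType f] [QuasiCompact f],
      (∀ n : ℕ, {α : ArithPsi.EffZeroCycle X | ArithPsi.cycleDegree f α = n}.Finite) ∧
      (∀ n : ℕ, ∀ᶠ S : Finset (closedPoints X) in atTop,
        PowerSeries.coeff n (∏ x ∈ S, ArithPsi.hasseWeilFactor f x) =
          PowerSeries.coeff n (ArithPsi.hasseWeilZeta f)) ∧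
      PowerSeries.constantCoeff (ArithPsi.hasseWeilZeta f) = 1 ∧
      ArithPsi.psiSeries f =
        ArithPsi.hasseWeilZeta f *
          PowerSeries.rescale (Nat.card k : ℚ) (ArithPsi.hasseWeilZeta f) *
          (PowerSeries.expand 2 two_ne_zero (ArithPsi.hasseWeilZeta f))⁻¹) ∧
    -- The statement for arithmetic schemes.
    (∀ (X : Scheme.{0}) (f : X ⟶ Spec (.of ℤ)) [LocallyOfFiniteType f] [QuasiCompact f],
      -- As an identity of formal Dirichlet series.
      ((∀ n : ℕ, ∀ᶠ S : Finset Nat.Primes in atTop,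
          (∏ p ∈ S, ArithPsi.psiFactor f p) n = ArithPsi.formalPsi f n) ∧
        (∀ n : ℕ, ∀ᶠ S : Finset (closedPoints X) in atTop,
          (∏ x ∈ S, ArithPsi.zetaFactor X x) n = ArithPsi.formalZeta X n) ∧
        (∀ n : ℕ, ∀ᶠ S : Finset (closedPoints (ArithPsi.affineLine X)) in atTop,
          (∏ x ∈ S, ArithPsi.zetaFactor (ArithPsi.affineLine X) x) n =
            ArithPsi.formalZeta (ArithPsi.affineLine X) n) ∧
        IsUnit (ArithPsi.atTwoS (ArithPsi.formalZeta X)) ∧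
        ArithPsi.formalPsi f * ArithPsi.atTwoS (ArithPsi.formalZeta X) =
          ArithPsi.formalZeta X * ArithPsi.formalZeta (ArithPsi.affineLine X)) ∧
      -- As an identity of functions: the set of absolute convergence contains a half-plane.
      (∃ σ : ℝ, ∀ r : ℝ, σ < r → Summable fun y : closedPoints (ArithPsi.affineLine X) =>
        (ArithPsi.pointNorm (ArithPsi.affineLine X) y : ℝ) ^ (-r)) ∧
      -- The identity holds wherever the zeta function of `X × 𝔸¹` converges absolutely.
      (∀ s : ℂ, (Summable fun y : closedPoints (ArithPsi.affineLine X) =>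
          (ArithPsi.pointNorm (ArithPsi.affineLine X) y : ℝ) ^ (-s.re)) →
        (∀ p : Nat.Primes, Summable fun α : ArithPsi.EffZeroCycle (ArithPsi.primeFibre f p) =>
          (ArithPsi.psi (ArithPsi.primeFibreMap f p) α : ℂ) *
            ((p : ℂ) ^ (-s)) ^ ArithPsi.cycleDegree (ArithPsi.primeFibreMap f p) α) ∧
        (Multipliable fun p : Nat.Primes =>
          ArithPsi.psiValue (ArithPsi.primeFibreMap f p) ((p : ℂ) ^ (-s))) ∧
        (Multipliable fun x : closedPoints X =>
          (1 - (ArithPsi.pointNorm X x : ℂ) ^ (-s))⁻¹) ∧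
        (Multipliable fun x : closedPoints X =>
          (1 - (ArithPsi.pointNorm X x : ℂ) ^ (-(2 * s)))⁻¹) ∧
        (Multipliable fun y : closedPoints (ArithPsi.affineLine X) =>
          (1 - (ArithPsi.pointNorm (ArithPsi.affineLine X) y : ℂ) ^ (-s))⁻¹) ∧
        ArithPsi.zeta X (2 * s) ≠ 0 ∧
        ArithPsi.globalPsi f s =
          ArithPsi.zeta X s * ArithPsi.zeta (ArithPsi.affineLine X) s /
            ArithPsi.zeta X (2 * s))) := by
  refine ⟨fun k _ _ X f _ _ => ?_, fun X f _ _ => ⟨?_, ?_, fun s h => ?_⟩⟩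
  · exact ⟨ArithPsi.finite_setOf_cycleDegree_eq f,
      ArithPsi.eventually_coeff_prod_hasseWeilFactor f, ArithPsi.constantCoeff_hasseWeilZeta f,
      ArithPsi.psiSeries_eq f⟩
  · exact ⟨ArithPsi.eventually_prod_psiFactor f, ArithPsi.eventually_prod_zetaFactor f,
      ArithPsi.eventually_prod_zetaFactor ((ArithPsi.affineLine X ↘ X) ≫ f),
      ArithPsi.isUnit_atTwoS_formalZeta f, ArithPsi.formalPsi_mul_atTwoS f⟩
  · exact ArithPsi.exists_summable_pointNorm_rpow ((ArithPsi.affineLine X ↘ X) ≫ f)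
  · have h₂ := ArithPsi.summable_affineLine_re_two_mul f h
    have hne := ArithPsi.zeta_ne_zero f h₂
    exact ⟨ArithPsi.summable_psi_mul_pow f h, (ArithPsi.hasProd_globalPsi f h).multipliable,
      ArithPsi.multipliable_zeta f h, ArithPsi.multipliable_zeta f h₂,
      ArithPsi.multipliable_zeta_affineLine f h, hne,
      eq_div_of_mul_eq hne (ArithPsi.globalPsi_mul_zeta f h)⟩
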